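/- Let $\mathbb{K}$ be a field, let $G$ be an abelian group, and let $R=\bigoplus_{\gamma\in G}R_\gamma$ be a $G$-graded $\mathbb{K}$-algebra (associative and unital). Let $\hbar\in R_\varepsilon$ be a homogeneous element of degree $\varepsilon\in G$ that is regular (neither a left nor a right zero divisor), normal ($\hbar R=R\hbar$) and not invertible. Put $\bar R:=R/\hbar R$ with the induced $G$-grading, in which $\bar R_\gamma$ is the image of $R_\gamma$. For a $G$-graded $\mathbb{K}$-algebra $A$, let $A^e=A\otimes_{\mathbb{K}}A^{o}$, where $A^o$ is the opposite algebra, be its enveloping algebra, graded by total degree, and let $\mathrm{Mod}^G A^e$ be the category of $G$-graded left $A^e$-modules (that is, $G$-graded $A$-bimodules) with degree-preserving $A^e$-linear maps. The algebra $A$ is called homologically $G$-smooth if the graded bimodule $A$ has a bounded projective resolution $0\to P_n\to\cdots\to P_1\to P_0\to A\to 0$ in $\mathrm{Mod}^G A^e$ in which every term is finitely generated. Proposition. Suppose that there is a group homomorphism $p:G\to\mathbb{Z}$ such that $p(\gamma)\ge 0$ for every $\gamma\in G$ with $R_\gamma\neq 0$, and $p(\varepsilon)>0$. If $\bar R$ is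 homologically $G$-smooth, then $R$ is homologically $G$-smooth. -/

import Mathlib

open scoped TensorProduct

namespace NormalExt

universe u v w x

/-! ### Graded modules over a graded ring -/

section GradedModules

variable {G : Type x} [AddCommGroup G] [DecidableEq G]
variable {K : Type v} [CommRing K] {A : Type u} [Ring A] [Algebra K A]

/-- An object of `Mod^G A`: a left `A`-module `M` with a decomposition `M = ⨁ M_γ` into additive
subgroups such that `A_α M_β ⊆ M_{α+β}`. (The `M_γ` are then `K`-subspaces, as `K · 1 ⊆ A_0`.) -/
structure GrMod (𝒜 : G → Submodule K A) where
  carrier : Type w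
  [addCommGroup : AddCommGroup carrier]
  [module : Module A carrier]
  piece : G → AddSubgroup carrier
  isInternal : DirectSum.IsInternal piece
  smul_mem : ∀ {α β : G} {a : A} {m : carrier},
    a ∈ 𝒜 α → m ∈ piece β → a • m ∈ piece (α + β)

attribute [instance] GrMod.addCommGroup GrMod.module

variable {𝒜 : G → Submodule K A}

/-- A morphism of `Mod^G A`: an `A`-linear map that preserves degrees. -/
structure GrHom (M : GrMod.{u, v, w} 𝒜) (N : GrMod.{u, v, w} 𝒜) where
  toLinearMap : M.carrier →ₗ[A] N.carrier
  map_mem : ∀ {γ : G} {m : M.carrier}, m ∈ M.piece γ → toLinearMap m ∈ N.piece γ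

/-- Projectivity in `Mod^G A`: lifting against degree-preserving surjections. -/
def GrMod.IsProjective (P : GrMod.{u, v, w} 𝒜) : Prop :=
  ∀ (M N : GrMod.{u, v, w} 𝒜) (g : GrHom M N) (f : GrHom P N),
    Function.Surjective g.toLinearMap →
      ∃ h : GrHom P M, g.toLinearMap ∘ₗ h.toLinearMap = f.toLinearMap

/-- `M` has a bounded projective resolution
`0 → P n → ⋯ → P 1 → P 0 → M → 0` in `Mod^G A` with each term finitely generated. -/
def GrMod.HasBoundedFGProjectiveResolution (M : GrMod.{u, v, w} 𝒜) : Prop :=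
  ∃ (n : ℕ) (P : ℕ → GrMod.{u, v, w} 𝒜) (d : ∀ i, GrHom (P (i + 1)) (P i)) (η : GrHom (P 0) M),
    (∀ i, (P i).IsProjective) ∧
    (∀ i, Module.Finite A (P i).carrier) ∧
    (∀ i, n < i → Subsingleton (P i).carrier) ∧
    Function.Surjective η.toLinearMap ∧
    Function.Exact (d 0).toLinearMap η.toLinearMap ∧
    ∀ i, Function.Exact (d (i + 1)).toLinearMap (d i).toLinearMap

end GradedModules

/-! ### The enveloping algebra and homological smoothness -/

section Smooth

variable {G : Type x} [AddCommGroup G] [DecidableEq G]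
variable {K : Type v} [Field K] {A : Type u} [Ring A] [Algebra K A]

/-- The `G`-grading of the enveloping algebra `A^e = A ⊗ A^o`: the component of degree `γ` is
spanned by the `a ⊗ b^o` with `a ∈ A_α`, `b ∈ A_β`, `α + β = γ`. -/
def envGrading (𝒜 : G → Submodule K A) (γ : G) : Submodule K (A ⊗[K] Aᵐᵒᵖ) :=
  Submodule.span K
    {t | ∃ α β : G, α + β = γ ∧ ∃ a ∈ 𝒜 α, ∃ b ∈ 𝒜 β, t = a ⊗ₜ[K] MulOpposite.op b}

/-- `A` as a graded `A`-bimodule, that is, as an object of `Mod^G A^e`;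
the action is `(a ⊗ b^o) • m = a * m * b`. -/
def regularBimodule (𝒜 : G → Submodule K A) [GradedAlgebra 𝒜] :
    GrMod.{u, v, u} (envGrading 𝒜) where
  carrier := A
  module := TensorProduct.Algebra.module
  piece γ := (𝒜 γ).toAddSubgroup
  isInternal := DirectSum.Decomposition.isInternal 𝒜
  smul_mem := by
    intro γ δ t m ht hm
    have key : envGrading 𝒜 γ ≤ (𝒜 (γ + δ)).comap
        ((TensorProduct.Algebra.moduleAux (R := K) (A := A) (B := Aᵐᵒᵖ) (M := A)).flip m) := by
      refine Submodule.span_le.2 ?_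
      rintro _ ⟨α, β, rfl, a, ha, b, hb, rfl⟩
      change a * (m * b) ∈ 𝒜 (α + β + δ)
      rw [add_assoc, add_comm β δ]
      exact SetLike.mul_mem_graded ha (SetLike.mul_mem_graded hm hb)
    exact key ht

theorem regularBimodule_smul_def (𝒜 : G → Submodule K A) [GradedAlgebra 𝒜] (a b m : A) :
    (show A from (a ⊗ₜ[K] MulOpposite.op b : A ⊗[K] Aᵐᵒᵖ) •
      (show (regularBimodule 𝒜).carrier from m)) = a * (m * b) := rfl

/-- `A` is homologically `G`-smooth: it has a bounded projective resolution in `Mod^G A^e` with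
each term finitely generated. -/
def IsHomologicallySmooth (𝒜 : G → Submodule K A) [GradedAlgebra 𝒜] : Prop :=
  (regularBimodule 𝒜).HasBoundedFGProjectiveResolution

end Smooth

/-! ### Normal elements and graded quotient algebras -/

section Quotient

variable {G : Type x} [AddCommGroup G] [DecidableEq G]
variable {K : Type v} [Field K] {R : Type u} [Ring R] [Algebra K R]

/-- `z` is homogeneous of degree `ε`, regular (neither a left nor a right zero divisor),
normal (`zR = Rz`) and not invertible. -/
structure IsNormalExtensionElement (𝒜 : G → Submodule K R) (z : R) (ε : G) : Prop where
  mem : z ∈ 𝒜 ε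
  isRegular : IsRegular z
  normal : Set.range (fun a : R => z * a) = Set.range (fun a : R => a * z)
  not_isUnit : ¬ IsUnit z

variable {𝒜 : G → Submodule K R} [GradedAlgebra 𝒜]

/-- The ideal `(z) = Rz = zR`, which is homogeneous because `z` is. -/
def IsNormalExtensionElement.ideal {z : R} {ε : G} (hz : IsNormalExtensionElement 𝒜 z ε) :
    HomogeneousIdeal 𝒜 where
  toSubmodule := Ideal.span {z}
  is_homogeneous' := Ideal.homogeneous_span 𝒜 {z} (by
    rintro _ rfl
    exact ⟨ε, hz.mem⟩)

instance IsNormalExtensionElement.isTwoSided {z : R} {ε : G}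
    (hz : IsNormalExtensionElement 𝒜 z ε) : hz.ideal.toIdeal.IsTwoSided where
  mul_mem_of_left := by
    intro a b ha
    change a ∈ Ideal.span {z} at ha
    change a * b ∈ Ideal.span {z}
    obtain ⟨c, rfl⟩ := Ideal.mem_span_singleton'.1 ha
    obtain ⟨e, he⟩ : z * b ∈ Set.range (fun a : R => a * z) := hz.normal ▸ ⟨b, rfl⟩
    exact Ideal.mem_span_singleton'.2 ⟨c * e, by
      simp only at he
      rw [mul_assoc, he, mul_assoc]⟩

/-- The natural grading of `R ⧸ I` for a homogeneous two-sided ideal `I`: the component of degree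
`γ` is the image of `R_γ`. -/
def quotientGrading (I : HomogeneousIdeal 𝒜) [I.toIdeal.IsTwoSided] (γ : G) :
    Submodule K (R ⧸ I.toIdeal) :=
  (𝒜 γ).map (Ideal.Quotient.mkₐ K I.toIdeal).toLinearMap

theorem quotientGrading_isInternal (I : HomogeneousIdeal 𝒜) [I.toIdeal.IsTwoSided] :
    DirectSum.IsInternal (quotientGrading I) := by
  classical
  let φ : ∀ γ, 𝒜 γ →+ quotientGrading I γ := fun γ =>
    { toFun := fun a => ⟨Ideal.Quotient.mk I.toIdeal a, a, a.2, rfl⟩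
      map_zero' := Subtype.ext (by simp)
      map_add' := fun a b => Subtype.ext (by simp) }
  have hφ : ∀ γ, Function.Surjective (φ γ) := by
    rintro γ ⟨_, a, ha, rfl⟩
    exact ⟨⟨a, ha⟩, rfl⟩
  let Φ := DirectSum.map φ
  have hΦ : Function.Surjective Φ := (DirectSum.map_surjective φ).2 hφ
  have hcomp : ∀ t, DirectSum.coeAddMonoidHom (quotientGrading I) (Φ t) =
      Ideal.Quotient.mk I.toIdeal (DirectSum.coeAddMonoidHom 𝒜 t) := by
    intro t
    induction t using DirectSum.induction_on with
    | zero => simp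
    | of i a => simp [Φ, DirectSum.map_of, φ]
    | add s t hs ht => simp only [map_add, hs, ht]
  constructor
  · rw [injective_iff_map_eq_zero]
    intro t ht
    obtain ⟨s, rfl⟩ := hΦ t
    rw [hcomp, Ideal.Quotient.eq_zero_iff_mem] at ht
    ext γ
    have h := (Ideal.IsHomogeneous.mem_iff 𝒜 I.isHomogeneous).1 ht γ
    have h2 : DirectSum.decompose 𝒜 (DirectSum.coeAddMonoidHom 𝒜 s) = s :=
      (DirectSum.decompose 𝒜).apply_symm_apply s
    rw [h2] at h
    simpa [Φ, DirectSum.map_apply, φ] using Ideal.Quotient.eq_zero_iff_mem.2 h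
  · intro y
    obtain ⟨a, rfl⟩ := Ideal.Quotient.mk_surjective y
    exact ⟨Φ (DirectSum.decompose 𝒜 a), by
      rw [hcomp]
      exact congrArg _ ((DirectSum.decompose 𝒜).symm_apply_apply a)⟩

noncomputable instance quotientGradedAlgebra (I : HomogeneousIdeal 𝒜) [I.toIdeal.IsTwoSided] :
    GradedAlgebra (quotientGrading I) where
  one_mem := ⟨1, SetLike.GradedOne.one_mem, map_one (Ideal.Quotient.mk I.toIdeal)⟩
  mul_mem := by
    rintro i j _ _ ⟨a, ha, rfl⟩ ⟨b, hb, rfl⟩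
    exact ⟨a * b, SetLike.mul_mem_graded ha hb, map_mul (Ideal.Quotient.mk I.toIdeal) a b⟩
  __ := (quotientGrading_isInternal I).chooseDecomposition

end Quotient

end NormalExt

namespace NormalExt

universe u v w x

/-! ### Homogeneous components -/

section Components

/-! Write `z` for the normal element, `R̄ = R/zR`, and pass from `R̄ ⊗ R̄^o` to `R ⊗ R^o` through
`R̄ ⊗ R^o`. Each of the maps `R ⊗ R^o → R̄ ⊗ R^o → R̄ ⊗ R̄^o` is a graded quotient by one regular
normal homogeneous element, `z ⊗ 1` and `1 ⊗ z` respectively (`NormalQuotient.tensorRight`,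
`NormalQuotient.tensorLeft`), and all degrees stay nonnegative along `p`.

For such a quotient `A → B = A/zA`, finitely generated graded projectives lift
(`exists_lift_projective`). Present one by an idempotent on a free `B`-module and lift this to a
degree-preserving endomorphism `f` over `A`. The map `f(1 - f)` lands in `zF`, and is nilpotent
because `p ε > 0` while the degrees of `F` are bounded below; a polynomial in `f` is then an
idempotent lift. The lift `P` has no `z`-torsion, and `zP` is again finitely generated projective.

The smoothness of `R̄` enters at the second map. Since projectives over `R̄ ⊗ R̄^o` have a two-term
resolution over `R̄ ⊗ R^o`, the bimodule `R̄` keeps a finite resolution there, with one more term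
(`hasRes_of_projective_ker`). At the first map, `R` has no `z ⊗ 1`-torsion and reduces to `R̄`, so
the resolution lifts term by term by the graded Nakayama lemma (`hasRes_of_torsionFree`). -/

theorem isInternal_of_proj {G : Type x} [DecidableEq G] {M σ : Type*} [AddCommGroup M]
    [SetLike σ M] [AddSubgroupClass σ M] (S : G → σ) (pr : G → M →+ M)
    (same : ∀ γ, ∀ m ∈ S γ, pr γ m = m)
    (ne : ∀ γ δ, γ ≠ δ → ∀ m ∈ S γ, pr δ m = 0)
    (hsup : ∀ m, m ∈ AddSubgroup.closure {m | ∃ γ, m ∈ S γ}) : DirectSum.IsInternal S := by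
  constructor
  · rw [injective_iff_map_eq_zero]
    intro t ht
    have key : ∀ s : DirectSum G fun γ => S γ, ∀ δ,
        pr δ (DirectSum.coeAddMonoidHom S s) = s δ := by
      intro s δ
      induction s using DirectSum.induction_on with
      | zero => simp
      | of i a =>
        rw [DirectSum.coeAddMonoidHom_of]
        by_cases h : i = δ
        · subst h
          rw [same _ _ a.2, DirectSum.of_eq_same]
        · rw [ne _ _ h _ a.2, DirectSum.of_eq_of_ne _ _ _ (Ne.symm h)]
          rfl
      | add s t hs ht => simp [hs, ht]
    ext δ
    rw [← key, ht, map_zero]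
    rfl
  · intro m
    suffices h : AddSubgroup.closure {m | ∃ γ, m ∈ S γ} ≤
        (DirectSum.coeAddMonoidHom S).range from h (hsup m)
    rw [AddSubgroup.closure_le]
    rintro m ⟨γ, hm⟩
    exact ⟨DirectSum.of (fun γ => S γ) γ ⟨m, hm⟩, DirectSum.coeAddMonoidHom_of _ _ _⟩

variable {G : Type x} [AddCommGroup G] [DecidableEq G]
variable {K : Type v} [CommRing K] {A : Type u} [Ring A] [Algebra K A]
variable {𝒜 : G → Submodule K A}

noncomputable instance GrMod.decomposition (M : GrMod.{u, v, w} 𝒜) :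
    DirectSum.Decomposition M.piece :=
  M.isInternal.chooseDecomposition

/-- The projection onto the component of degree `γ`. -/
noncomputable def GrMod.proj (M : GrMod.{u, v, w} 𝒜) (γ : G) : M.carrier →+ M.carrier :=
  (M.piece γ).subtype.comp ((DFinsupp.evalAddMonoidHom γ).comp
    (DirectSum.decomposeAddEquiv M.piece).toAddMonoidHom)

namespace GrMod

variable (M N : GrMod.{u, v, w} 𝒜)

theorem proj_apply (γ : G) (m : M.carrier) :
    M.proj γ m = DirectSum.decompose M.piece m γ := rfl

theorem proj_mem (γ : G) (m : M.carrier) : M.proj γ m ∈ M.piece γ :=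
  (DirectSum.decompose M.piece m γ).2

variable {M N}

theorem proj_of_mem {γ : G} {m : M.carrier} (hm : m ∈ M.piece γ) : M.proj γ m = m :=
  DirectSum.decompose_of_mem_same M.piece hm

theorem proj_of_mem_ne {γ δ : G} {m : M.carrier} (hm : m ∈ M.piece γ) (h : γ ≠ δ) :
    M.proj δ m = 0 :=
  DirectSum.decompose_of_mem_ne M.piece hm h

theorem exists_eq_sum_proj (m : M.carrier) : ∃ s : Finset G, m = ∑ γ ∈ s, M.proj γ m := by
  classical
  exact ⟨_, (DirectSum.sum_support_decompose M.piece m).symm⟩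

theorem induction_on {motive : M.carrier → Prop} (m : M.carrier) (zero : motive 0)
    (homogeneous : ∀ γ, ∀ m ∈ M.piece γ, motive m)
    (add : ∀ m n, motive m → motive n → motive (m + n)) : motive m :=
  DirectSum.Decomposition.inductionOn M.piece zero (fun {i} m => homogeneous i m m.2) add m

theorem proj_smul {ε γ : G} {a : A} (ha : a ∈ 𝒜 ε) (m : M.carrier) :
    M.proj (ε + γ) (a • m) = a • M.proj γ m := by
  induction m using induction_on with
  | zero => simp
  | add m n hm hn => simp [hm, hn]
  | homogeneous δ m hm =>
    by_cases h : δ = γ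
    · subst h
      rw [proj_of_mem hm, proj_of_mem (M.smul_mem ha hm)]
    · rw [proj_of_mem_ne hm h, proj_of_mem_ne (M.smul_mem ha hm) (by simpa using h), smul_zero]

theorem mem_of_proj_eq {γ : G} {m : M.carrier} (h : M.proj γ m = m) : m ∈ M.piece γ :=
  h ▸ M.proj_mem γ m

end GrMod

namespace GrHom

variable {M N L : GrMod.{u, v, w} 𝒜}

theorem map_proj (f : GrHom M N) (γ : G) (m : M.carrier) :
    f.toLinearMap (M.proj γ m) = N.proj γ (f.toLinearMap m) := by
  induction m using GrMod.induction_on with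
  | zero => simp
  | add m n hm hn => simp [hm, hn]
  | homogeneous δ m hm =>
    by_cases h : δ = γ
    · subst h
      rw [GrMod.proj_of_mem hm, GrMod.proj_of_mem (f.map_mem hm)]
    · rw [GrMod.proj_of_mem_ne hm h, GrMod.proj_of_mem_ne (f.map_mem hm) h, map_zero]

theorem mem_of_injective (f : GrHom M N) (hf : Function.Injective f.toLinearMap) {γ : G}
    {m : M.carrier} (hm : f.toLinearMap m ∈ N.piece γ) : m ∈ M.piece γ := by
  refine GrMod.mem_of_proj_eq (hf ?_)
  rw [map_proj, GrMod.proj_of_mem hm]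

theorem exists_mem_of_mem_range (f : GrHom M N) {γ : G} {n : N.carrier} (hn : n ∈ N.piece γ)
    (h : ∃ m, f.toLinearMap m = n) : ∃ m ∈ M.piece γ, f.toLinearMap m = n := by
  obtain ⟨m, rfl⟩ := h
  exact ⟨M.proj γ m, M.proj_mem γ m, by rw [map_proj, GrMod.proj_of_mem hn]⟩

/-- The identity morphism. -/
def id (M : GrMod.{u, v, w} 𝒜) : GrHom M M where
  toLinearMap := LinearMap.id
  map_mem h := h

/-- Composition of morphisms. -/
def comp (g : GrHom N L) (f : GrHom M N) : GrHom M L where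
  toLinearMap := g.toLinearMap ∘ₗ f.toLinearMap
  map_mem h := g.map_mem (f.map_mem h)

/-- A difference of morphisms. -/
def sub (f g : GrHom M N) : GrHom M N where
  toLinearMap := f.toLinearMap - g.toLinearMap
  map_mem h := sub_mem (f.map_mem h) (g.map_mem h)

/-- The zero morphism. -/
def zero (M N : GrMod.{u, v, w} 𝒜) : GrHom M N where
  toLinearMap := 0
  map_mem _ := zero_mem _

/-- The factorization is graded because an injective graded map reflects degrees. -/
theorem exists_factor (i : GrHom M N) (hi : Function.Injective i.toLinearMap) (f : GrHom L N)
    (h : ∀ l, ∃ m, i.toLinearMap m = f.toLinearMap l) :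
    ∃ g : GrHom L M, ∀ l, i.toLinearMap (g.toLinearMap l) = f.toLinearMap l := by
  choose g hg using h
  refine ⟨⟨⟨⟨g, fun a b => hi ?_⟩, fun a b => hi ?_⟩, fun {γ l} hl => ?_⟩, hg⟩
  · simp [hg]
  · simp [hg]
  · refine mem_of_injective i hi ?_
    change i.toLinearMap (g l) ∈ _
    rw [hg]
    exact f.map_mem hl

end GrHom

/-! ### Constructions of graded modules -/

namespace GrMod

variable {M N : GrMod.{u, v, w} 𝒜}

/-- A homogeneous submodule as a graded module. -/
def ofSubmodule (M : GrMod.{u, v, w} 𝒜) (L : Submodule A M.carrier)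
    (hL : ∀ γ, ∀ m ∈ L, M.proj γ m ∈ L) : GrMod.{u, v, w} 𝒜 where
  carrier := L
  piece γ := (M.piece γ).comap L.subtype.toAddMonoidHom
  isInternal := by
    refine isInternal_of_proj _
      (fun γ => ((M.proj γ).comp L.subtype.toAddMonoidHom).codRestrict L
        (fun m => hL γ _ m.2)) ?_ ?_ ?_
    · intro γ m hm
      exact Subtype.ext (proj_of_mem hm)
    · intro γ δ h m hm
      exact Subtype.ext (proj_of_mem_ne hm h)
    · intro m
      obtain ⟨s, hs⟩ := exists_eq_sum_proj (M := M) m.1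
      have : m = ∑ γ ∈ s, (⟨M.proj γ m.1, hL γ _ m.2⟩ : L) := by
        apply Subtype.ext
        rw [AddSubmonoidClass.coe_finsetSum]
        exact hs
      rw [this]
      exact sum_mem fun γ _ => AddSubgroup.subset_closure ⟨γ, M.proj_mem γ m.1⟩
  smul_mem ha hm := M.smul_mem ha hm

/-- The inclusion of a homogeneous submodule. -/
def ofSubmoduleHom (M : GrMod.{u, v, w} 𝒜) (L : Submodule A M.carrier)
    (hL : ∀ γ, ∀ m ∈ L, M.proj γ m ∈ L) : GrHom (M.ofSubmodule L hL) M where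
  toLinearMap := L.subtype
  map_mem h := h

theorem exists_comap (f : GrHom M N) (L : Submodule A N.carrier)
    (hL : ∀ γ, ∀ m ∈ L, N.proj γ m ∈ L) :
    ∃ (X : GrMod.{u, v, w} 𝒜) (i : GrHom X M), Function.Injective i.toLinearMap ∧
      ∀ m, (∃ y, i.toLinearMap y = m) ↔ f.toLinearMap m ∈ L := by
  refine ⟨M.ofSubmodule (L.comap f.toLinearMap) ?_, ofSubmoduleHom _ _ _,
    Subtype.val_injective, fun m => ⟨?_, fun h => ⟨⟨m, h⟩, rfl⟩⟩⟩
  · intro γ m hm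
    rw [Submodule.mem_comap] at hm ⊢
    rw [f.map_proj]
    exact hL _ _ hm
  · rintro ⟨y, rfl⟩
    exact y.2

theorem exists_ker (f : GrHom M N) :
    ∃ (X : GrMod.{u, v, w} 𝒜) (i : GrHom X M), Function.Injective i.toLinearMap ∧
      Function.Exact i.toLinearMap f.toLinearMap := by
  obtain ⟨X, i, hi, h⟩ := exists_comap f ⊥ (by
    intro γ m hm
    rw [Submodule.mem_bot] at hm ⊢
    rw [hm, map_zero])
  exact ⟨X, i, hi, fun m => (h m).symm⟩

/-- The direct sum of two graded modules. -/
def prod (M N : GrMod.{u, v, w} 𝒜) : GrMod.{u, v, w} 𝒜 where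
  carrier := M.carrier × N.carrier
  piece γ := (M.piece γ).prod (N.piece γ)
  isInternal := by
    refine isInternal_of_proj _ (fun γ => (M.proj γ).prodMap (N.proj γ)) ?_ ?_ ?_
    · rintro γ ⟨m, n⟩ ⟨hm, hn⟩
      exact Prod.ext (proj_of_mem hm) (proj_of_mem hn)
    · rintro γ δ h ⟨m, n⟩ ⟨hm, hn⟩
      exact Prod.ext (proj_of_mem_ne hm h) (proj_of_mem_ne hn h)
    · rintro ⟨m, n⟩
      have h1 : ((m, 0) : M.carrier × N.carrier) ∈ AddSubgroup.closure
          {m | ∃ γ, m ∈ (M.piece γ).prod (N.piece γ)} := by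
        induction m using induction_on with
        | zero => exact zero_mem _
        | homogeneous γ m hm => exact AddSubgroup.subset_closure ⟨γ, hm, zero_mem _⟩
        | add m n hm hn => simpa using add_mem hm hn
      have h2 : ((0, n) : M.carrier × N.carrier) ∈ AddSubgroup.closure
          {m | ∃ γ, m ∈ (M.piece γ).prod (N.piece γ)} := by
        induction n using induction_on with
        | zero => exact zero_mem _
        | homogeneous γ m hm => exact AddSubgroup.subset_closure ⟨γ, zero_mem _, hm⟩
        | add m n hm hn => simpa using add_mem hm hn
      simpa using add_mem h1 h2
  smul_mem := fun ha hm => ⟨M.smul_mem ha hm.1, N.smul_mem ha hm.2⟩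

theorem IsProjective.of_retract {P Q : GrMod.{u, v, w} 𝒜} (hQ : Q.IsProjective) (i : GrHom P Q)
    (r : GrHom Q P) (h : ∀ x, r.toLinearMap (i.toLinearMap x) = x) : P.IsProjective := by
  intro M N g f hg
  obtain ⟨k, hk⟩ := hQ M N g (f.comp r) hg
  refine ⟨k.comp i, LinearMap.ext fun x => ?_⟩
  have := LinearMap.congr_fun hk (i.toLinearMap x)
  simpa [GrHom.comp, h] using this

theorem finite_of_retract {P Q : GrMod.{u, v, w} 𝒜} (hQ : Module.Finite A Q.carrier)
    (i : GrHom P Q) (r : GrHom Q P) (h : ∀ x, r.toLinearMap (i.toLinearMap x) = x) :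
    Module.Finite A P.carrier :=
  Module.Finite.of_surjective r.toLinearMap fun x => ⟨_, h x⟩

theorem IsProjective.prod {P Q : GrMod.{u, v, w} 𝒜} (hP : P.IsProjective) (hQ : Q.IsProjective) :
    (P.prod Q).IsProjective := by
  intro M N g f hg
  obtain ⟨k, hk⟩ := hP M N g ⟨f.toLinearMap ∘ₗ LinearMap.inl A P.carrier Q.carrier,
    fun hm => f.map_mem ⟨hm, zero_mem _⟩⟩ hg
  obtain ⟨l, hl⟩ := hQ M N g ⟨f.toLinearMap ∘ₗ LinearMap.inr A P.carrier Q.carrier,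
    fun hm => f.map_mem ⟨zero_mem _, hm⟩⟩ hg
  refine ⟨⟨LinearMap.coprod k.toLinearMap l.toLinearMap,
    fun hm => add_mem (k.map_mem hm.1) (l.map_mem hm.2)⟩, ?_⟩
  change g.toLinearMap ∘ₗ LinearMap.coprod _ _ = _
  rw [LinearMap.comp_coprod, hk, hl]
  exact LinearMap.coprod_comp_inl_inr _

theorem isProjective_of_subsingleton (P : GrMod.{u, v, w} 𝒜) [Subsingleton P.carrier] :
    P.IsProjective := by
  intro M N g f _
  refine ⟨GrHom.zero P M, LinearMap.ext fun x => ?_⟩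
  rw [Subsingleton.elim x 0, map_zero, map_zero]

end GrMod

/-! ### Finite resolutions by short exact sequences -/

/-- `M` has a resolution of length `< n` by finitely generated projectives. -/
inductive HasRes : ℕ → GrMod.{u, v, w} 𝒜 → Prop
  | zero (M : GrMod.{u, v, w} 𝒜) (h : Subsingleton M.carrier) : HasRes 0 M
  | succ (n : ℕ) (L P M : GrMod.{u, v, w} 𝒜) (i : GrHom L P) (f : GrHom P M)
      (hi : Function.Injective i.toLinearMap) (hf : Function.Surjective f.toLinearMap)
      (hex : Function.Exact i.toLinearMap f.toLinearMap) (hP : P.IsProjective)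
      (hfin : Module.Finite A P.carrier) (hL : HasRes n L) : HasRes (n + 1) M

/-- The tail of the complex resolves the kernel of the augmentation, which gives an induction on the
length. Short exact sequences are the form in which resolutions can be lifted one step at a time. -/
theorem hasRes_of_resolution (n : ℕ) : ∀ (M : GrMod.{u, v, w} 𝒜) (P : ℕ → GrMod.{u, v, w} 𝒜)
    (d : ∀ i, GrHom (P (i + 1)) (P i)) (η : GrHom (P 0) M) (_ : ∀ i, (P i).IsProjective)
    (_ : ∀ i, Module.Finite A (P i).carrier) (_ : ∀ i, n ≤ i → Subsingleton (P i).carrier)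
    (_ : Function.Surjective η.toLinearMap)
    (_ : Function.Exact (d 0).toLinearMap η.toLinearMap)
    (_ : ∀ i, Function.Exact (d (i + 1)).toLinearMap (d i).toLinearMap), HasRes n M := by
  induction n with
  | zero =>
    intro M P d η _ _ h0 hη _ _
    have := h0 0 le_rfl
    exact .zero M hη.subsingleton
  | succ n ih =>
    intro M P d η hP hfin h0 hη h1 hd
    obtain ⟨L, i, hi, hex⟩ := GrMod.exists_ker η
    obtain ⟨g, hg⟩ := i.exists_factor hi (d 0) fun l =>
      (hex _).1 ((h1 _).2 ⟨l, rfl⟩)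
    refine .succ n L (P 0) M i η hi hη hex (hP 0) (hfin 0)
      (ih L (fun j => P (j + 1)) (fun j => d (j + 1)) g (fun j => hP _) (fun j => hfin _)
        (fun j hj => h0 _ (by omega)) ?_ ?_ (fun j => hd _))
    · intro y
      obtain ⟨l, hl⟩ := (h1 _).1 ((hex _).2 ⟨y, rfl⟩)
      exact ⟨l, hi (by rw [hg, hl])⟩
    · intro y
      rw [← hd 0 y, ← hg, map_eq_zero_iff _ hi]

theorem HasRes.exists_resolution {n : ℕ} {M : GrMod.{u, v, w} 𝒜} (h : HasRes n M) :
    ∃ (P : ℕ → GrMod.{u, v, w} 𝒜) (d : ∀ i, GrHom (P (i + 1)) (P i)) (η : GrHom (P 0) M),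
    (∀ i, (P i).IsProjective) ∧
    (∀ i, Module.Finite A (P i).carrier) ∧
    (∀ i, n ≤ i → Subsingleton (P i).carrier) ∧
    Function.Surjective η.toLinearMap ∧
    Function.Exact (d 0).toLinearMap η.toLinearMap ∧
    ∀ i, Function.Exact (d (i + 1)).toLinearMap (d i).toLinearMap := by
  induction h with
  | zero M h =>
    refine ⟨fun _ => M, fun _ => GrHom.zero M M, GrHom.zero M M,
      fun _ => M.isProjective_of_subsingleton, fun _ => inferInstance, fun _ _ => h,
      fun x => ⟨0, Subsingleton.elim _ _⟩, fun x => ?_, fun _ x => ?_⟩ <;>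
    exact ⟨fun _ => ⟨0, Subsingleton.elim _ _⟩, fun _ => Subsingleton.elim _ _⟩
  | succ n L P M i f hi hf hex hP hfin hL ih =>
    obtain ⟨Q, d, η, hQ, hQf, hQ0, hη, h1, hd⟩ := ih
    refine ⟨fun | 0 => P | j + 1 => Q j, fun | 0 => i.comp η | j + 1 => d j, f, ?_, ?_, ?_,
      hf, ?_, ?_⟩
    · rintro (_ | j)
      exacts [hP, hQ j]
    · rintro (_ | j)
      exacts [hfin, hQf j]
    · rintro (_ | j) hj
      · omega
      · exact hQ0 j (by omega)
    · intro x
      rw [hex x]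
      constructor
      · rintro ⟨y, rfl⟩
        obtain ⟨z, rfl⟩ := hη y
        exact ⟨z, rfl⟩
      · rintro ⟨z, rfl⟩
        exact ⟨_, rfl⟩
    · rintro (_ | j)
      · intro x
        rw [← h1 x]
        exact map_eq_zero_iff _ hi
      · exact hd j

theorem hasBoundedFGProjectiveResolution_iff {M : GrMod.{u, v, w} 𝒜} :
    M.HasBoundedFGProjectiveResolution ↔ ∃ n, HasRes n M := by
  constructor
  · rintro ⟨n, P, d, η, h1, h2, h3, h4, h5, h6⟩
    -- A resolution may be nonzero in positions `0, …, n`, whereas `HasRes` counts terms.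
    exact ⟨n + 1, hasRes_of_resolution (n + 1) M P d η h1 h2 (fun i hi => h3 i hi) h4 h5 h6⟩
  · rintro ⟨n, h⟩
    obtain ⟨P, d, η, h1, h2, h3, h4, h5, h6⟩ := h.exists_resolution
    exact ⟨n, P, d, η, h1, h2, fun i hi => h3 i hi.le, h4, h5, h6⟩

/-! ### Graded free modules -/

section Free

variable [GradedAlgebra 𝒜]

variable (𝒜) in
/-- The graded free module with a basis element of degree `d i` for each `i`. -/
def free {ι : Type u} [Finite ι] (d : ι → G) : GrMod.{u, v, u} 𝒜 where
  carrier := ι → A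
  piece γ :=
    { carrier := {v | ∀ i, v i ∈ 𝒜 (γ - d i)}
      zero_mem' := fun i => zero_mem _
      add_mem' := fun hv hw i => add_mem (hv i) (hw i)
      neg_mem' := fun hv i => neg_mem (hv i) }
  isInternal := by
    classical
    refine isInternal_of_proj _ (fun γ => AddMonoidHom.pi fun i =>
      (GradedRing.proj 𝒜 (γ - d i)).comp (Pi.evalAddMonoidHom (fun _ : ι => A) i)) ?_ ?_ ?_
    · intro γ m hm
      funext i
      exact DirectSum.decompose_of_mem_same 𝒜 (hm i)
    · intro γ δ h m hm
      funext i
      exact DirectSum.decompose_of_mem_ne 𝒜 (hm i) (by simpa using h)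
    · intro m
      cases nonempty_fintype ι
      rw [← Finset.univ_sum_single m]
      refine sum_mem fun i _ => ?_
      induction m i using DirectSum.Decomposition.inductionOn 𝒜 with
      | zero => simp
      | homogeneous a =>
        rename_i γ
        refine AddSubgroup.subset_closure ⟨γ + d i, fun j => ?_⟩
        by_cases h : j = i
        · subst h
          simp
        · simp [h]
      | add a b ha hb =>
        rw [Pi.single_add]
        exact add_mem ha hb
  smul_mem := by
    intro α β a m ha hm i
    rw [add_sub_assoc]
    exact SetLike.mul_mem_graded ha (hm i)

variable {ι : Type u} [Finite ι] (d : ι → G)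

instance free_finite : Module.Finite A (free 𝒜 d).carrier :=
  inferInstanceAs (Module.Finite A (ι → A))

theorem single_mem_free [DecidableEq ι] (i : ι) :
    (show (free 𝒜 d).carrier from Pi.single i (1 : A)) ∈ (free 𝒜 d).piece (d i) := by
  intro j
  by_cases h : j = i
  · subst h
    simpa using SetLike.GradedOne.one_mem
  · simp [h]

theorem exists_free_hom {M : GrMod.{u, v, u} 𝒜} [DecidableEq ι] (m : ι → M.carrier)
    (hm : ∀ i, m i ∈ M.piece (d i)) :
    ∃ f : GrHom (free 𝒜 d) M, ∀ i,
      f.toLinearMap (show (free 𝒜 d).carrier from Pi.single i (1 : A)) = m i := by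
  cases nonempty_fintype ι
  refine ⟨⟨Fintype.linearCombination A m, ?_⟩, fun i => ?_⟩
  · intro γ v hv
    suffices h : ∑ i, (v i : A) • m i ∈ M.piece γ from h
    refine sum_mem fun i _ => ?_
    have := M.smul_mem (hv i) (hm i)
    rwa [sub_add_cancel] at this
  · change Fintype.linearCombination A m _ = _
    simp

theorem free_hom_ext {N : Type*} [AddCommGroup N] [Module A N] [DecidableEq ι]
    {f g : (free 𝒜 d).carrier →ₗ[A] N}
    (h : ∀ i, f (show (free 𝒜 d).carrier from Pi.single i (1 : A)) =
      g (show (free 𝒜 d).carrier from Pi.single i (1 : A))) : f = g := by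
  refine LinearMap.pi_ext' (R := A) (φ := fun _ : ι => A) fun i => LinearMap.ext_ring ?_
  exact h i

theorem free_isProjective : (free 𝒜 d).IsProjective := by
  classical
  intro M N g f hg
  have : ∀ i, ∃ m ∈ M.piece (d i), g.toLinearMap m =
      f.toLinearMap (show (free 𝒜 d).carrier from Pi.single i (1 : A)) := fun i =>
    g.exists_mem_of_mem_range (f.map_mem (single_mem_free d i)) (hg _)
  choose m hm hgm using this
  obtain ⟨h, hh⟩ := exists_free_hom d m hm
  refine ⟨h, free_hom_ext d fun i => ?_⟩
  rw [LinearMap.comp_apply, hh, hgm]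

/-- The homogeneous elements span `M`, so finitely many of them already generate; their degrees
become the degrees of the basis. -/
theorem exists_free_surjective (M : GrMod.{u, v, u} 𝒜) [Module.Finite A M.carrier] :
    ∃ (ι : Type u) (_ : Finite ι) (d : ι → G) (f : GrHom (free 𝒜 d) M),
      Function.Surjective f.toLinearMap := by
  classical
  have hspan : Submodule.span A {m | ∃ γ, m ∈ M.piece γ} = ⊤ := by
    rw [eq_top_iff]
    rintro m -
    induction m using GrMod.induction_on with
    | zero => exact zero_mem _
    | homogeneous γ m hm => exact Submodule.subset_span ⟨γ, hm⟩
    | add m n hm hn => exact add_mem hm hn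
  have hfg : (Submodule.span A {m | ∃ γ, m ∈ M.piece γ}).FG := hspan ▸ Module.Finite.fg_top
  obtain ⟨t, ht, hts⟩ := (Submodule.fg_span_iff_fg_span_finset_subset _).1 hfg
  choose deg hdeg using ht
  obtain ⟨f, hf⟩ := exists_free_hom (𝒜 := 𝒜) (fun i : t => deg i.2) (fun i => i.1)
    (fun i => hdeg i.2)
  refine ⟨t, inferInstance, _, f, ?_⟩
  rw [← LinearMap.range_eq_top, eq_top_iff, ← hspan, hts, Submodule.span_le]
  intro m hm
  exact ⟨_, hf ⟨m, hm⟩⟩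

end Free

end Components

/-! ### Quotients by a regular normal homogeneous element -/

section NormalQuotient

variable {G : Type x} [AddCommGroup G]
variable {K : Type v} [CommRing K] {A B : Type u} [Ring A] [Algebra K A] [Ring B] [Algebra K B]

/-- `π : A → B` is a graded surjection whose kernel is generated by the homogeneous regular normal
element `z` of degree `ε`. -/
structure NormalQuotient (𝒜 : G → Submodule K A) (ℬ : G → Submodule K B) (π : A →+* B) (z : A)
    (ε : G) : Prop where
  mem : z ∈ 𝒜 ε
  isRegular : IsRegular z
  exists_mul_left : ∀ a, ∃ b, z * a = b * z
  exists_mul_right : ∀ a, ∃ b, a * z = z * b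
  map_mem : ∀ {γ a}, a ∈ 𝒜 γ → π a ∈ ℬ γ
  exists_lift : ∀ {γ b}, b ∈ ℬ γ → ∃ a ∈ 𝒜 γ, π a = b
  map_eq_zero_iff : ∀ a, π a = 0 ↔ ∃ b, a = z * b

variable [DecidableEq G] {𝒜 : G → Submodule K A} {ℬ : G → Submodule K B} {π : A →+* B}
  {z : A} {ε : G}

namespace NormalQuotient

variable (h : NormalQuotient 𝒜 ℬ π z ε)
include h

omit [AddCommGroup G] [DecidableEq G] in
theorem map_self : π z = 0 := (h.map_eq_zero_iff z).2 ⟨1, (mul_one z).symm⟩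

theorem surjective [GradedAlgebra ℬ] : Function.Surjective π := by
  intro b
  induction b using DirectSum.Decomposition.inductionOn ℬ with
  | zero => exact ⟨0, map_zero π⟩
  | homogeneous b =>
    obtain ⟨a, -, ha⟩ := h.exists_lift b.2
    exact ⟨a, ha⟩
  | add b c hb hc =>
    obtain ⟨a, rfl⟩ := hb
    obtain ⟨a', rfl⟩ := hc
    exact ⟨a + a', map_add π _ _⟩

/-- Restriction of scalars along `π`. -/
def res (N : GrMod.{u, v, w} ℬ) : GrMod.{u, v, w} 𝒜 where
  carrier := N.carrier
  module := Module.compHom N.carrier π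
  piece := N.piece
  isInternal := N.isInternal
  smul_mem ha hm := N.smul_mem (h.map_mem ha) hm

theorem res_smul (N : GrMod.{u, v, w} ℬ) (a : A) (n : N.carrier) :
    (show N.carrier from a • (show (h.res N).carrier from n)) = π a • n := rfl

/-- Restriction of scalars along `π` on morphisms. -/
def resHom {M N : GrMod.{u, v, w} ℬ} (f : GrHom M N) : GrHom (h.res M) (h.res N) where
  toLinearMap :=
    { toFun := f.toLinearMap
      map_add' := f.toLinearMap.map_add
      map_smul' := fun a m => f.toLinearMap.map_smul (π a) m }
  map_mem hm := f.map_mem hm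

theorem smul_res (N : GrMod.{u, v, w} ℬ) (n : (h.res N).carrier) : z • n = 0 := by
  refine (h.res_smul N z n).trans ?_
  rw [h.map_self]
  exact zero_smul B (show N.carrier from n)

omit h in
theorem exists_mem_smul_eq {M : GrMod.{u, v, w} 𝒜} {γ : G} {m : M.carrier} (hz : z ∈ 𝒜 ε)
    (hm : m ∈ M.piece γ) (y : M.carrier) (hy : m = z • y) :
    m = z • M.proj (γ - ε) y := by
  rw [← GrMod.proj_smul hz, ← hy, add_sub_cancel, GrMod.proj_of_mem hm]

section Free

variable [GradedAlgebra 𝒜] [GradedAlgebra ℬ] {ι : Type u} [Finite ι] (d : ι → G)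

/-- Reduction of free modules. -/
def freeRed : GrHom (free 𝒜 d) (h.res (free ℬ d)) where
  toLinearMap :=
    { toFun := fun v i => π (v i)
      map_add' := fun v w => funext fun i => map_add π (v i) (w i)
      map_smul' := fun a v => funext fun i => map_mul π a (v i) }
  map_mem hv i := h.map_mem (hv i)

theorem freeRed_surjective : Function.Surjective (h.freeRed d).toLinearMap := fun v =>
  ⟨fun i => (h.surjective (v i)).choose, funext fun i => (h.surjective (v i)).choose_spec⟩

theorem freeRed_eq_zero_iff (v : (free 𝒜 d).carrier) :
    (h.freeRed d).toLinearMap v = 0 ↔ ∃ y : (free 𝒜 d).carrier, v = z • y := by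
  constructor
  · intro hv
    have : ∀ i, ∃ b, v i = z * b := fun i => (h.map_eq_zero_iff _).1 (congrFun hv i)
    choose y hy using this
    exact ⟨y, funext hy⟩
  · rintro ⟨y, rfl⟩
    rw [map_smul, h.smul_res]

omit [GradedAlgebra ℬ] in
theorem free_smul_eq_zero {v : (free 𝒜 d).carrier} (hv : z • v = 0) : v = 0 :=
  funext fun i => h.isRegular.left.mul_left_eq_zero_iff.1 (congrFun hv i)

/-- Right multiplication by `z` on free modules. -/
def freeMul : GrHom (free 𝒜 fun i => d i + ε) (free 𝒜 d) where
  toLinearMap :=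
    { toFun := fun v i => v i * z
      map_add' := fun v w => funext fun i => add_mul (v i) (w i) z
      map_smul' := fun a v => funext fun i => mul_assoc a (v i) z }
  map_mem := by
    intro γ v hv i
    have := SetLike.mul_mem_graded (hv i) h.mem
    rwa [← sub_sub, sub_add_cancel] at this

omit [GradedAlgebra ℬ] in
theorem freeMul_injective : Function.Injective (h.freeMul d).toLinearMap := fun _ _ hvw =>
  funext fun i => h.isRegular.right (congrFun hvw i)

-- Normality gives `Fz = zF` coordinatewise. Left multiplication by `z` need not be `A`-linear, but
-- right multiplication is, so this exhibits `zF` as a shifted copy of the free module.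
omit [GradedAlgebra ℬ] in
theorem exists_freeMul_eq_iff (v : (free 𝒜 d).carrier) :
    (∃ y, (h.freeMul d).toLinearMap y = v) ↔ ∃ y : (free 𝒜 d).carrier, v = z • y := by
  constructor
  · rintro ⟨y, rfl⟩
    choose u hu using fun i => h.exists_mul_right (y i)
    exact ⟨u, funext hu⟩
  · rintro ⟨y, rfl⟩
    choose u hu using fun i => h.exists_mul_left (y i)
    exact ⟨u, funext fun i => (hu i).symm⟩

end Free

end NormalQuotient

/-! ### Boundedness below, graded Nakayama and nilpotency -/

/-- The degrees occurring in `M` are bounded below along `p`. -/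
def GrMod.BoundedBelow (p : G →+ ℤ) (M : GrMod.{u, v, w} 𝒜) : Prop :=
  ∃ b : ℤ, ∀ γ, p γ < b → ∀ m ∈ M.piece γ, m = 0

theorem GrMod.BoundedBelow.of_injective {p : G →+ ℤ} {M N : GrMod.{u, v, w} 𝒜}
    (hN : N.BoundedBelow p) (i : GrHom M N) (hi : Function.Injective i.toLinearMap) :
    M.BoundedBelow p := by
  obtain ⟨b, hb⟩ := hN
  exact ⟨b, fun γ hγ m hm => hi (by rw [hb γ hγ _ (i.map_mem hm), map_zero])⟩

theorem free_boundedBelow [GradedAlgebra 𝒜] {p : G →+ ℤ} (hp : ∀ γ, 𝒜 γ ≠ ⊥ → 0 ≤ p γ)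
    {ι : Type u} [Finite ι] (d : ι → G) : (free 𝒜 d).BoundedBelow p := by
  obtain ⟨b, hb⟩ := (Set.finite_range fun i => p (d i)).bddBelow
  refine ⟨b, fun γ hγ v hv => funext fun i => ?_⟩
  have hi : b ≤ p (d i) := hb ⟨i, rfl⟩
  by_contra hne
  have := hp (γ - d i) fun hbot => hne ((Submodule.mem_bot K).1 (hbot ▸ hv i))
  rw [map_sub] at this
  omega

/-- Graded Nakayama lemma for surjectivity. -/
theorem surjective_of_boundedBelow {p : G →+ ℤ} (hε : 0 < p ε) (hz : z ∈ 𝒜 ε)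
    {M L : GrMod.{u, v, w} 𝒜} (hM : M.BoundedBelow p) (f : GrHom L M)
    (hf : ∀ m, ∃ l y, m = f.toLinearMap l + z • y) : Function.Surjective f.toLinearMap := by
  obtain ⟨b, hb⟩ := hM
  -- Induction on the height above the lower bound `b`: taking components of degree `γ` in `m = f l
  -- + z y` leaves a `y` of degree `γ - ε`, which is strictly lower because `p ε > 0`.
  have key : ∀ n : ℕ, ∀ γ, p γ < b + n → ∀ m ∈ M.piece γ, m ∈ LinearMap.range f.toLinearMap := by
    intro n
    induction n with
    | zero =>
      intro γ hγ m hm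
      rw [hb γ (by simpa using hγ) m hm]
      exact zero_mem _
    | succ n ih =>
      intro γ hγ m hm
      obtain ⟨l, y, hy⟩ := hf m
      have h1 : m = f.toLinearMap (L.proj γ l) + z • M.proj (γ - ε) y := by
        rw [f.map_proj, ← GrMod.proj_smul hz, add_sub_cancel, ← map_add, ← hy,
          GrMod.proj_of_mem hm]
      rw [h1]
      refine add_mem ⟨_, rfl⟩ (Submodule.smul_mem _ _ (ih (γ - ε) ?_ _ (M.proj_mem _ _)))
      rw [map_sub]
      push_cast at hγ
      omega
  intro m
  change m ∈ LinearMap.range f.toLinearMap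
  induction m using GrMod.induction_on with
  | zero => exact zero_mem _
  | homogeneous γ m hm => exact key (p γ - b + 1).toNat γ (by omega) m hm
  | add m n hm hn => exact add_mem hm hn

/-- The graded endomorphisms of a graded module. -/
def GrMod.grEnd (M : GrMod.{u, v, w} 𝒜) : Subring (Module.End A M.carrier) where
  carrier := {φ | ∀ γ, ∀ m ∈ M.piece γ, φ m ∈ M.piece γ}
  mul_mem' hφ hψ γ m hm := hφ γ _ (hψ γ m hm)
  one_mem' _ _ hm := hm
  add_mem' hφ hψ γ m hm := add_mem (hφ γ m hm) (hψ γ m hm)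
  zero_mem' _ _ _ := zero_mem _
  neg_mem' hφ γ m hm := neg_mem (hφ γ m hm)

/-- Each application of `ψ` extracts one more factor `z` and lowers the degree of the cofactor by
`ε`. On the finitely many basis vectors the cofactor eventually falls below the lower bound of the
degrees. -/
theorem free_pow_eq_zero [GradedAlgebra 𝒜] {p : G →+ ℤ} (hp : ∀ γ, 𝒜 γ ≠ ⊥ → 0 ≤ p γ)
    (hε : 0 < p ε) (hz : z ∈ 𝒜 ε) {ι : Type u} [Finite ι] (d : ι → G)
    {ψ : Module.End A (free 𝒜 d).carrier} (hψ : ψ ∈ (free 𝒜 d).grEnd)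
    (hψz : ∀ v, ∃ y, ψ v = z • y) : ∃ N : ℕ, ψ ^ N = 0 := by
  classical
  obtain ⟨b, hb⟩ := free_boundedBelow hp d
  obtain ⟨c, hc⟩ := (Set.finite_range fun i => p (d i)).bddAbove
  have key : ∀ k : ℕ, ∀ γ, ∀ v ∈ (free 𝒜 d).piece γ,
      ∃ y ∈ (free 𝒜 d).piece (γ - k • ε), (ψ ^ k) v = z ^ k • y := by
    intro k
    induction k with
    | zero => exact fun γ v hv => ⟨v, by simpa using hv, by simp⟩
    | succ k ih =>
      intro γ v hv
      obtain ⟨y, hy, h1⟩ := ih γ v hv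
      obtain ⟨u, hu⟩ := hψz y
      have h2 := NormalQuotient.exists_mem_smul_eq hz (hψ _ _ hy) u hu
      refine ⟨(free 𝒜 d).proj (γ - k • ε - ε) u, ?_, ?_⟩
      · have := GrMod.proj_mem (free 𝒜 d) (γ - k • ε - ε) u
        rwa [sub_sub, ← succ_nsmul] at this ⊢
      · rw [pow_succ', Module.End.mul_apply, h1, map_smul, h2, smul_smul, ← pow_succ]
  -- A basis vector has `p`-degree at most `c`, so after `c - b + 1` steps, each costing `p ε ≥ 1`,
  -- the cofactor has `p`-degree below `b` and vanishes.
  refine ⟨(c - b + 1).toNat, free_hom_ext d fun i => ?_⟩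
  obtain ⟨y, hy, h1⟩ := key (c - b + 1).toNat (d i) _ (single_mem_free d i)
  have hi : p (d i) ≤ c := hc ⟨i, rfl⟩
  rw [h1, hb _ ?_ y hy, smul_zero, LinearMap.zero_apply]
  rw [map_sub, map_nsmul, nsmul_eq_mul]
  have : ((c - b + 1).toNat : ℤ) ≤ (c - b + 1).toNat * p ε :=
    le_mul_of_one_le_right (by positivity) hε
  omega

/-- Polynomial lifting of an element which is idempotent modulo nilpotents. -/
theorem isIdempotentElem_of_pow_eq_zero {E : Type*} [Ring E] {φ : E} {N : ℕ}
    (h : (φ * (1 - φ)) ^ N = 0) : IsIdempotentElem (1 - (1 - φ ^ N) ^ N) := by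
  -- With `e = 1 - (1 - X^N)^N`, the power `X^N` divides `e` and `(1 - X)^N` divides `1 - e`; hence
  -- `e(1 - e)` dies at `φ`.
  have hdvd : (Polynomial.X * (1 - Polynomial.X) : Polynomial ℤ) ^ N ∣
      (1 - (1 - Polynomial.X ^ N) ^ N) * (1 - Polynomial.X ^ N) ^ N := by
    rw [mul_pow]
    refine mul_dvd_mul ?_ (pow_dvd_pow_of_dvd (one_sub_dvd_one_sub_pow _ _) _)
    have hX := one_sub_dvd_one_sub_pow (1 - Polynomial.X ^ N : Polynomial ℤ) N
    rwa [show (1 - (1 - Polynomial.X ^ N) : Polynomial ℤ) = Polynomial.X ^ N by ring] at hX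
  obtain ⟨q, hq⟩ := hdvd
  have := congrArg (Polynomial.aeval φ) hq
  simp only [map_mul, map_sub, map_pow, map_one, Polynomial.aeval_X, h, zero_mul] at this
  rw [IsIdempotentElem, mul_sub, mul_one, this, sub_zero]

/-! ### Lifting idempotents, projectives and resolutions along the quotient -/

namespace NormalQuotient

variable (h : NormalQuotient 𝒜 ℬ π z ε) [GradedAlgebra 𝒜] [GradedAlgebra ℬ]
include h

theorem exists_lift_idempotent {p : G →+ ℤ} (hp : ∀ γ, 𝒜 γ ≠ ⊥ → 0 ≤ p γ) (hε : 0 < p ε)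
    {ι : Type u} [Finite ι] (d : ι → G) (e₀ : GrHom (free ℬ d) (free ℬ d))
    (he₀ : ∀ v, e₀.toLinearMap (e₀.toLinearMap v) = e₀.toLinearMap v) :
    ∃ e : GrHom (free 𝒜 d) (free 𝒜 d),
      (∀ v, e.toLinearMap (e.toLinearMap v) = e.toLinearMap v) ∧
      ∀ v, (h.freeRed d).toLinearMap (e.toLinearMap v) =
        (h.resHom e₀).toLinearMap ((h.freeRed d).toLinearMap v) := by
  set r := (h.freeRed d).toLinearMap with hr
  set e₁ : Module.End A (h.res (free ℬ d)).carrier := (h.resHom e₀).toLinearMap with he₁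
  -- Freeness gives a lift of `e₀`, idempotent only modulo `z`.
  obtain ⟨φ, hφ⟩ := free_isProjective d _ _ (h.freeRed d) ((h.resHom e₀).comp (h.freeRed d))
    (h.freeRed_surjective d)
  set f : Module.End A (free 𝒜 d).carrier := φ.toLinearMap with hf
  have he₁i : IsIdempotentElem e₁ := LinearMap.ext he₀
  have hfr : ∀ v, r (f v) = e₁ (r v) := LinearMap.congr_fun hφ
  have hpow : ∀ (f : Module.End A (free 𝒜 d).carrier)
      (e₁ : Module.End A (h.res (free ℬ d)).carrier) (_ : ∀ v, r (f v) = e₁ (r v)) (n : ℕ) (v),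
      r ((f ^ n) v) = (e₁ ^ n) (r v) := by
    intro f e₁ hfr n
    induction n with
    | zero => exact fun v => rfl
    | succ n ih =>
      intro v
      rw [pow_succ', pow_succ', Module.End.mul_apply, Module.End.mul_apply, hfr, ih]
  have hfm : f ∈ (free 𝒜 d).grEnd := fun γ m hm => φ.map_mem hm
  obtain ⟨N, hN⟩ := free_pow_eq_zero hp hε h.mem d
    (mul_mem hfm (sub_mem (one_mem _) hfm)) (fun v => (h.freeRed_eq_zero_iff d _).1 (by
      rw [Module.End.mul_apply, LinearMap.sub_apply, map_sub, Module.End.one_apply, map_sub]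
      rw [← hr, hfr, hfr, hfr, ← Module.End.mul_apply, he₁i.eq, sub_self]))
  -- A positive exponent is needed so that the powers of the idempotents `e₁` and `1 - e₁` below
  -- equal the idempotents themselves; then the corrected endomorphism still reduces to `e₁`.
  have hN1 : (f * (1 - f)) ^ (N + 1) = 0 := by rw [pow_succ, hN, zero_mul]
  have hidem := isIdempotentElem_of_pow_eq_zero hN1
  have hmem : 1 - (1 - f ^ (N + 1)) ^ (N + 1) ∈ (free 𝒜 d).grEnd :=
    sub_mem (one_mem _) (pow_mem (sub_mem (one_mem _) (pow_mem hfm _)) _)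
  refine ⟨⟨1 - (1 - f ^ (N + 1)) ^ (N + 1), fun {γ m} hm => hmem γ m hm⟩,
    LinearMap.congr_fun hidem, fun v => ?_⟩
  have h1 : ∀ v, r ((1 - f ^ (N + 1)) v) = (1 - e₁) (r v) := by
    intro v
    rw [LinearMap.sub_apply, map_sub, hpow f e₁ hfr, he₁i.pow_succ_eq]
    rfl
  change r ((1 - (1 - f ^ (N + 1)) ^ (N + 1)) v) = e₁ (r v)
  rw [LinearMap.sub_apply, map_sub, hpow _ _ h1, he₁i.one_sub.pow_succ_eq]
  simp

/-- Finitely generated graded projective modules lift along `π`. -/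
theorem exists_lift_projective {p : G →+ ℤ} (hp : ∀ γ, 𝒜 γ ≠ ⊥ → 0 ≤ p γ) (hε : 0 < p ε)
    (Q : GrMod.{u, v, u} ℬ) (hQ : Q.IsProjective) (hfin : Module.Finite B Q.carrier) :
    ∃ (P P₁ : GrMod.{u, v, u} 𝒜) (q : GrHom P (h.res Q)) (i : GrHom P₁ P),
      P.IsProjective ∧ Module.Finite A P.carrier ∧ P₁.IsProjective ∧
      Module.Finite A P₁.carrier ∧ Function.Surjective q.toLinearMap ∧
      Function.Injective i.toLinearMap ∧ Function.Exact i.toLinearMap q.toLinearMap ∧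
      (∀ x, q.toLinearMap x = 0 ↔ ∃ y : P.carrier, x = z • y) ∧
      (∀ x : P.carrier, z • x = 0 → x = 0) ∧ P.BoundedBelow p := by
  obtain ⟨ι, _, d, f, hf⟩ := exists_free_surjective Q
  obtain ⟨s, hs⟩ := hQ _ _ f (GrHom.id Q) hf
  have hfs : ∀ x, f.toLinearMap (s.toLinearMap x) = x := LinearMap.congr_fun hs
  obtain ⟨e, he, her⟩ := h.exists_lift_idempotent hp hε d (s.comp f) (fun v => by
    change s.toLinearMap (f.toLinearMap (s.toLinearMap (f.toLinearMap v))) = _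
    rw [hfs]
    rfl)
  -- The image of the idempotent `e`, realized as the kernel of `1 - e`.
  obtain ⟨P, j, hj, hjex⟩ := GrMod.exists_ker ((GrHom.id _).sub e)
  have hjx : ∀ v, (∃ x, j.toLinearMap x = v) ↔ e.toLinearMap v = v := fun v => by
    refine (hjex v).symm.trans ?_
    change v - e.toLinearMap v = 0 ↔ _
    rw [sub_eq_zero, eq_comm]
  obtain ⟨t, ht⟩ := j.exists_factor hj e fun v => (hjx _).2 (he v)
  have htj : ∀ x, t.toLinearMap (j.toLinearMap x) = x := fun x =>
    hj (by rw [ht, (hjx _).1 ⟨x, rfl⟩])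
  let ρ := h.freeMul d
  have hρ := h.freeMul_injective d
  -- This is `zF ∩ P`, pulled back along the isomorphism `ρ` from the shifted free module onto `zF =
  -- Fz`. As `e` preserves `zF`, it transports to an endomorphism `e'` that retracts the shifted
  -- free module onto `P₁`, which is therefore projective.
  obtain ⟨P₁, k, hk, hkex⟩ := GrMod.exists_ker (((GrHom.id _).sub e).comp ρ)
  have hkx : ∀ v, (∃ x, k.toLinearMap x = v) ↔
      e.toLinearMap (ρ.toLinearMap v) = ρ.toLinearMap v := fun v => by
    refine (hkex v).symm.trans ?_
    change ρ.toLinearMap v - e.toLinearMap (ρ.toLinearMap v) = 0 ↔ _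
    rw [sub_eq_zero, eq_comm]
  obtain ⟨e', he'⟩ := ρ.exists_factor hρ (e.comp ρ) fun v => by
    obtain ⟨y, hy⟩ := (h.exists_freeMul_eq_iff d _).1 ⟨v, rfl⟩
    refine (h.exists_freeMul_eq_iff d _).2 ⟨e.toLinearMap y, ?_⟩
    change e.toLinearMap (ρ.toLinearMap v) = _
    rw [hy, map_smul]
  have he'x : ∀ v, ρ.toLinearMap (e'.toLinearMap v) = e.toLinearMap (ρ.toLinearMap v) := he'
  obtain ⟨t₁, ht₁⟩ := k.exists_factor hk e' fun v => (hkx _).2 (by rw [he'x, he])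
  have htk : ∀ x, t₁.toLinearMap (k.toLinearMap x) = x := fun x =>
    hk (hρ (by rw [ht₁, he'x, (hkx _).1 ⟨x, rfl⟩]))
  obtain ⟨i, hi⟩ := j.exists_factor hj (ρ.comp k) fun x => (hjx _).2 ((hkx _).1 ⟨x, rfl⟩)
  have hix : ∀ x, j.toLinearMap (i.toLinearMap x) = ρ.toLinearMap (k.toLinearMap x) := hi
  let q : GrHom P (h.res Q) := (h.resHom f).comp ((h.freeRed d).comp j)
  have hq0 : ∀ x, q.toLinearMap x = 0 ↔
      ∃ y : (free 𝒜 d).carrier, j.toLinearMap x = z • y := by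
    intro x
    rw [← h.freeRed_eq_zero_iff]
    constructor
    · intro hx
      -- Since `e` fixes `j x`, the reduction of `j x` is `s (q x)`, so it vanishes with `q x`.
      have h1 := her (j.toLinearMap x)
      rw [(hjx _).1 ⟨x, rfl⟩] at h1
      rw [h1]
      change s.toLinearMap (q.toLinearMap x) = 0
      rw [hx]
      exact map_zero s.toLinearMap
    · intro hx
      change (h.resHom f).toLinearMap ((h.freeRed d).toLinearMap (j.toLinearMap x)) = 0
      rw [hx, map_zero]
  refine ⟨P, P₁, q, i, (free_isProjective d).of_retract j t htj,
    GrMod.finite_of_retract (free_finite d) j t htj, (free_isProjective _).of_retract k t₁ htk,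
    GrMod.finite_of_retract (free_finite _) k t₁ htk, ?_, ?_, ?_, ?_, ?_,
    (free_boundedBelow hp d).of_injective j hj⟩
  · intro y
    obtain ⟨v, hv⟩ := h.freeRed_surjective d (s.toLinearMap y)
    refine ⟨t.toLinearMap v, ?_⟩
    change (h.resHom f).toLinearMap ((h.freeRed d).toLinearMap (j.toLinearMap _)) = y
    rw [ht, her, hv]
    change f.toLinearMap (s.toLinearMap (f.toLinearMap (s.toLinearMap y))) = y
    exact (hfs _).trans (hfs y)
  · intro x y hxy
    exact hk (hρ (by rw [← hix, ← hix, hxy]))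
  · intro x
    rw [hq0, ← h.exists_freeMul_eq_iff]
    constructor
    · rintro ⟨v, hv⟩
      have hv : ρ.toLinearMap v = j.toLinearMap x := hv
      obtain ⟨y, rfl⟩ := (hkx v).2 (by rw [hv, (hjx _).1 ⟨x, rfl⟩])
      exact ⟨y, hj (by rw [hix, hv])⟩
    · rintro ⟨y, rfl⟩
      exact ⟨_, (hix y).symm⟩
  · intro x
    rw [hq0]
    constructor
    · rintro ⟨y, hy⟩
      refine ⟨t.toLinearMap y, ?_⟩
      rw [← map_smul, ← hy, htj]
    · rintro ⟨y, rfl⟩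
      exact ⟨j.toLinearMap y, map_smul _ _ _⟩
  · intro x hx
    refine hj ?_
    rw [map_zero]
    refine h.free_smul_eq_zero d ?_
    rw [← map_smul, hx, map_zero]

/-- Resolutions lift from `M / zM` to `M` if `z` is regular on `M`. -/
theorem hasRes_of_torsionFree {p : G →+ ℤ} (hp : ∀ γ, 𝒜 γ ≠ ⊥ → 0 ≤ p γ) (hε : 0 < p ε)
    {n : ℕ} {N : GrMod.{u, v, u} ℬ} (hN : HasRes n N) :
    ∀ (M : GrMod.{u, v, u} 𝒜) (q : GrHom M (h.res N)) (_ : Function.Surjective q.toLinearMap)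
      (_ : ∀ x, q.toLinearMap x = 0 ↔ ∃ y : M.carrier, x = z • y)
      (_ : ∀ x : M.carrier, z • x = 0 → x = 0) (_ : M.BoundedBelow p), HasRes n M := by
  induction hN with
  | zero N hN =>
    intro M q _ hq _ hM
    have hs : Subsingleton (h.res N).carrier := hN
    refine .zero M ?_
    -- Here `M = zM`; Nakayama is applied to the inclusion of the zero module, obtained as the
    -- kernel of the identity.
    obtain ⟨X, i, hi, hex⟩ := GrMod.exists_ker (GrHom.id M)
    have hX : Subsingleton X.carrier := ⟨fun x y => by
      have hx := (hex _).2 ⟨x, rfl⟩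
      have hy := (hex _).2 ⟨y, rfl⟩
      exact hi (hx.trans hy.symm)⟩
    refine (surjective_of_boundedBelow hε h.mem hM i fun m => ?_).subsingleton
    obtain ⟨y, hy⟩ := (hq m).1 (Subsingleton.elim _ _)
    exact ⟨0, y, by rw [map_zero, zero_add, hy]⟩
  | succ n L Q N i g hi hg hex hQ hfin hL ih =>
    intro M q hqs hq hz hM
    obtain ⟨P, -, qP, -, hP, hPf, -, -, hqP, -, -, hqPz, hPz, hPb⟩ :=
      h.exists_lift_projective hp hε Q hQ hfin
    obtain ⟨f, hf⟩ := hP _ _ q ((h.resHom g).comp qP) hqs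
    have hqf : ∀ x, q.toLinearMap (f.toLinearMap x) =
      (h.resHom g).toLinearMap (qP.toLinearMap x) := LinearMap.congr_fun hf
    have hfs : Function.Surjective f.toLinearMap := by
      refine surjective_of_boundedBelow hε h.mem hM f fun m => ?_
      obtain ⟨b, hb⟩ := hg (q.toLinearMap m)
      obtain ⟨x, hx⟩ := hqP b
      obtain ⟨y, hy⟩ := (hq (m - f.toLinearMap x)).1 (by
        rw [map_sub, hqf, hx, sub_eq_zero]
        exact hb.symm)
      exact ⟨x, y, by rw [← hy]; abel⟩
    obtain ⟨M', j, hj, hjex⟩ := GrMod.exists_ker f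
    have hi' : Function.Injective (h.resHom i).toLinearMap := hi
    obtain ⟨q', hq'⟩ := (h.resHom i).exists_factor hi' (qP.comp j) fun x => by
      refine (hex _).1 ?_
      change (h.resHom g).toLinearMap (qP.toLinearMap (j.toLinearMap x)) = 0
      rw [← hqf, (hjex _).2 ⟨x, rfl⟩, map_zero]
    have hq'x : ∀ x, (h.resHom i).toLinearMap (q'.toLinearMap x) =
      qP.toLinearMap (j.toLinearMap x) := hq'
    refine .succ n M' P M j f hj hfs hjex hP hPf (ih M' q' ?_ ?_ ?_ (hPb.of_injective j hj))
    · intro l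
      obtain ⟨x, hx⟩ := hqP ((h.resHom i).toLinearMap l)
      -- A lift `x` of an element of `L` has `f x` in `zM = f(zP)`. Subtracting a suitable `z x'`
      -- moves it into `ker f` without changing its reduction.
      obtain ⟨y, hy⟩ := (hq (f.toLinearMap x)).1 (by
        rw [hqf, hx]
        exact (hex _).2 ⟨l, rfl⟩)
      obtain ⟨x', rfl⟩ := hfs y
      obtain ⟨m, hm⟩ := (hjex (x - z • x')).1 (by rw [map_sub, map_smul, hy, sub_self])
      refine ⟨m, hi' ?_⟩
      rw [hq'x, hm, map_sub, map_smul, hx, h.smul_res, sub_zero]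
    · intro x
      rw [← _root_.map_eq_zero_iff _ hi', hq'x, hqPz]
      constructor
      -- Torsion-freeness of `M` gives `ker f ∩ zP = z (ker f)`: if `f (z y) = 0`, then `f y = 0`.
      · rintro ⟨y, hy⟩
        obtain ⟨m, rfl⟩ := (hjex y).1 (hz _ (by
          rw [← map_smul, ← hy, (hjex _).2 ⟨x, rfl⟩]))
        exact ⟨m, hj (by rw [hy, map_smul])⟩
      · rintro ⟨y, rfl⟩
        exact ⟨j.toLinearMap y, map_smul _ _ _⟩
    · intro x hx
      refine hj ?_
      rw [map_zero]
      refine hPz _ ?_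
      rw [← map_smul, hx, map_zero]

/-- Change of rings for resolutions along `π`. -/
theorem hasRes_of_projective_ker {p : G →+ ℤ} (hp : ∀ γ, 𝒜 γ ≠ ⊥ → 0 ≤ p γ) (hε : 0 < p ε)
    {n : ℕ} {N : GrMod.{u, v, u} ℬ} (hN : HasRes n N) :
    ∀ (M P₀ : GrMod.{u, v, u} 𝒜) (q : GrHom M (h.res N)) (k : GrHom P₀ M)
      (_ : Function.Surjective q.toLinearMap) (_ : Function.Injective k.toLinearMap)
      (_ : Function.Exact k.toLinearMap q.toLinearMap) (_ : P₀.IsProjective)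
      (_ : Module.Finite A P₀.carrier), HasRes (n + 1) M := by
  induction hN with
  | zero N hN =>
    intro M P₀ q k hq hk hex hP₀ hfin
    have hs : Subsingleton (h.res N).carrier := hN
    -- With `N = 0` the map `k` is an isomorphism, so `P₀` alone resolves `M`.
    obtain ⟨X, i, hi, hiex⟩ := GrMod.exists_ker k
    refine .succ 0 X P₀ M i k hi (fun m => (hex m).1 (Subsingleton.elim _ _)) hiex hP₀ hfin
      (.zero X ⟨fun x y => hi (hk ?_)⟩)
    rw [(hiex _).2 ⟨x, rfl⟩, (hiex _).2 ⟨y, rfl⟩]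
  | succ n L Q N i g hi hg hex hQ hfin hL ih =>
    intro M P₀ q k hqs hk hkex hP₀ hP₀f
    obtain ⟨P, P₁, qP, i₁, hP, hPf, hP₁, hP₁f, hqP, hi₁, hi₁ex, -⟩ :=
      h.exists_lift_projective hp hε Q hQ hfin
    obtain ⟨f, hf⟩ := hP _ _ q ((h.resHom g).comp qP) hqs
    have hqf : ∀ x, q.toLinearMap (f.toLinearMap x) =
      (h.resHom g).toLinearMap (qP.toLinearMap x) := LinearMap.congr_fun hf
    -- `M'` is the kernel of `P → N`. It maps onto `L` with kernel `P₁ = ker (P → Q)`, again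
    -- projective, which is why the induction allows a projective kernel. Moreover `M'` is the
    -- kernel of `P₀ ⊕ P → M`; the sign in `a` makes the composite zero.
    obtain ⟨M', j, hj, hjex⟩ := GrMod.exists_ker (q.comp f)
    have hjq : ∀ x, q.toLinearMap (f.toLinearMap (j.toLinearMap x)) = 0 := fun x =>
      (hjex _).2 ⟨x, rfl⟩
    obtain ⟨l, hl⟩ := k.exists_factor hk (f.comp j) fun x => (hkex _).1 (hjq x)
    have hlx : ∀ x, k.toLinearMap (l.toLinearMap x) = f.toLinearMap (j.toLinearMap x) := hl
    let a : GrHom M' (P₀.prod P) :=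
      ⟨LinearMap.prod (-l.toLinearMap) j.toLinearMap,
        fun hm => ⟨(P₀.piece _).neg_mem (l.map_mem hm), j.map_mem hm⟩⟩
    let b : GrHom (P₀.prod P) M :=
      ⟨LinearMap.coprod k.toLinearMap f.toLinearMap,
        fun hm => add_mem (k.map_mem hm.1) (f.map_mem hm.2)⟩
    have hi' : Function.Injective (h.resHom i).toLinearMap := hi
    obtain ⟨q', hq'⟩ := (h.resHom i).exists_factor hi' (qP.comp j) fun x => by
      refine (hex _).1 ?_
      change (h.resHom g).toLinearMap (qP.toLinearMap (j.toLinearMap x)) = 0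
      rw [← hqf, hjq]
    have hq'x : ∀ x, (h.resHom i).toLinearMap (q'.toLinearMap x) =
      qP.toLinearMap (j.toLinearMap x) := hq'
    obtain ⟨k', hk'⟩ := j.exists_factor hj i₁ fun x => (hjex _).1 (by
      change q.toLinearMap (f.toLinearMap (i₁.toLinearMap x)) = 0
      rw [hqf, (hi₁ex _).2 ⟨x, rfl⟩, map_zero])
    refine .succ (n + 1) M' (P₀.prod P) M a b (fun x y hxy => hj (congrArg Prod.snd hxy)) ?_ ?_
      (hP₀.prod hP) (inferInstanceAs (Module.Finite A (P₀.carrier × P.carrier)))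
      (ih M' P₁ q' k' ?_ ?_ ?_ hP₁ hP₁f)
    · intro m
      obtain ⟨y, hy⟩ := hg (q.toLinearMap m)
      obtain ⟨x, hx⟩ := hqP y
      obtain ⟨x₀, hx₀⟩ := (hkex (m - f.toLinearMap x)).1 (by
        rw [map_sub, hqf, hx, sub_eq_zero]
        exact hy.symm)
      refine ⟨(x₀, x), ?_⟩
      change k.toLinearMap x₀ + f.toLinearMap x = m
      rw [hx₀, sub_add_cancel]
    · rintro ⟨x₀, x⟩
      constructor
      · intro hx
        have hx : k.toLinearMap x₀ + f.toLinearMap x = 0 := hx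
        obtain ⟨y, rfl⟩ := (hjex x).1 (by
          change q.toLinearMap (f.toLinearMap x) = 0
          rw [← neg_eq_iff_add_eq_zero.2 hx, map_neg, (hkex _).2 ⟨x₀, rfl⟩, neg_zero])
        refine ⟨y, Prod.ext (hk ?_) rfl⟩
        change k.toLinearMap (-l.toLinearMap y) = k.toLinearMap x₀
        rw [map_neg, hlx, ← eq_neg_of_add_eq_zero_left hx]
      · rintro ⟨y, hy⟩
        have h1 : -l.toLinearMap y = x₀ := congrArg Prod.fst hy
        have h2 : j.toLinearMap y = x := congrArg Prod.snd hy
        change k.toLinearMap x₀ + f.toLinearMap x = 0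
        rw [← h1, ← h2, map_neg, hlx, neg_add_cancel]
    · intro y
      obtain ⟨x, hx⟩ := hqP ((h.resHom i).toLinearMap y)
      obtain ⟨m, rfl⟩ := (hjex x).1 (by
        change q.toLinearMap (f.toLinearMap x) = 0
        rw [hqf, hx]
        exact (hex _).2 ⟨y, rfl⟩)
      exact ⟨m, hi' (by rw [hq'x, hx])⟩
    · intro x y hxy
      exact hi₁ (by rw [← hk', ← hk', hxy])
    · intro x
      rw [← _root_.map_eq_zero_iff _ hi', hq'x, hi₁ex]
      constructor
      · rintro ⟨y, hy⟩
        exact ⟨y, hj (by rw [hk', hy])⟩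
      · rintro ⟨y, rfl⟩
        exact ⟨y, (hk' y).symm⟩

end NormalQuotient

end NormalQuotient

/-! ### Gradings of tensor products -/

section Mixed

variable {G : Type x} [AddCommGroup G]
variable {K : Type v} [Field K] {A B : Type u} [Ring A] [Algebra K A] [Ring B] [Algebra K B]

/-- The total grading of `A ⊗ B^o`. -/
def mixedGrading (𝒜 : G → Submodule K A) (ℬ : G → Submodule K B) (γ : G) :
    Submodule K (A ⊗[K] Bᵐᵒᵖ) :=
  Submodule.span K
    {t | ∃ α β : G, α + β = γ ∧ ∃ a ∈ 𝒜 α, ∃ b ∈ ℬ β, t = a ⊗ₜ[K] MulOpposite.op b}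

variable {𝒜 : G → Submodule K A} {ℬ : G → Submodule K B}

theorem tmul_mem_mixedGrading {α β : G} {a : A} {b : B} (ha : a ∈ 𝒜 α) (hb : b ∈ ℬ β) :
    a ⊗ₜ[K] MulOpposite.op b ∈ mixedGrading 𝒜 ℬ (α + β) :=
  Submodule.subset_span ⟨α, β, rfl, a, ha, b, hb, rfl⟩

theorem mixedGrading_ne_bot {γ : G} (h : mixedGrading 𝒜 ℬ γ ≠ ⊥) :
    ∃ α β, α + β = γ ∧ 𝒜 α ≠ ⊥ ∧ ℬ β ≠ ⊥ := by
  by_contra! hcon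
  refine h (Submodule.span_eq_bot.2 ?_)
  rintro _ ⟨α, β, rfl, a, ha, b, hb, rfl⟩
  by_cases hα : 𝒜 α = ⊥
  · rw [hα, Submodule.mem_bot] at ha
    rw [ha, TensorProduct.zero_tmul]
  · rw [hcon α β rfl hα, Submodule.mem_bot] at hb
    rw [hb, MulOpposite.op_zero, TensorProduct.tmul_zero]

theorem nonneg_of_mixedGrading_ne_bot {p : G →+ ℤ}
    (hA : ∀ γ, 𝒜 γ ≠ ⊥ → 0 ≤ p γ) (hB : ∀ γ, ℬ γ ≠ ⊥ → 0 ≤ p γ) (γ : G)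
    (h : mixedGrading 𝒜 ℬ γ ≠ ⊥) : 0 ≤ p γ := by
  obtain ⟨α, β, rfl, hα, hβ⟩ := mixedGrading_ne_bot h
  rw [map_add]
  exact add_nonneg (hA α hα) (hB β hβ)

variable [DecidableEq G] [GradedAlgebra 𝒜] [GradedAlgebra ℬ]

variable (𝒜 ℬ) in
/-- The projection of `A ⊗ B^o` onto the component of degree `γ`. -/
noncomputable def mixedProj (γ : G) : A ⊗[K] Bᵐᵒᵖ →ₗ[K] A ⊗[K] Bᵐᵒᵖ :=
  TensorProduct.lift ((DirectSum.toModule K G (Bᵐᵒᵖ →ₗ[K] A ⊗[K] Bᵐᵒᵖ) fun α =>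
    ((TensorProduct.mk K A Bᵐᵒᵖ).compl₂ ((MulOpposite.opLinearEquiv K).toLinearMap ∘ₗ
      GradedAlgebra.proj ℬ (γ - α) ∘ₗ (MulOpposite.opLinearEquiv K).symm.toLinearMap)) ∘ₗ
        (𝒜 α).subtype) ∘ₗ (DirectSum.decomposeLinearEquiv 𝒜).toLinearMap)

theorem mixedProj_tmul {α : G} {a : A} (ha : a ∈ 𝒜 α) (b : B) (γ : G) :
    mixedProj 𝒜 ℬ γ (a ⊗ₜ MulOpposite.op b) =
      a ⊗ₜ MulOpposite.op (GradedAlgebra.proj ℬ (γ - α) b) := by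
  have h : DirectSum.decomposeLinearEquiv 𝒜 a = DirectSum.lof K G (fun i => 𝒜 i) α ⟨a, ha⟩ :=
    DirectSum.decompose_of_mem 𝒜 ha
  simp [mixedProj, h]

/-- The maps `mixedProj` separate the components: on `a ⊗ b^o` with `a` of degree `α`, degree `γ` is
selected by projecting `b` to degree `γ - α`. -/
theorem mixedGrading_isInternal : DirectSum.IsInternal (mixedGrading 𝒜 ℬ) := by
  have key : ∀ γ δ, ∀ m ∈ mixedGrading 𝒜 ℬ γ,
      mixedProj 𝒜 ℬ δ m = if γ = δ then m else 0 := by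
    intro γ δ m hm
    induction hm using Submodule.span_induction with
    | zero => simp
    | add x y _ _ hx hy => rw [map_add, hx, hy]; split_ifs <;> simp
    | smul c x _ hx => rw [map_smul, hx]; split_ifs <;> simp
    | mem x hx =>
      obtain ⟨α, β, rfl, a, ha, b, hb, rfl⟩ := hx
      rw [mixedProj_tmul ha, GradedAlgebra.proj_apply]
      split_ifs with h
      · subst h
        rw [add_sub_cancel_left, DirectSum.decompose_of_mem_same ℬ hb]
      · rw [DirectSum.decompose_of_mem_ne ℬ hb fun h' => h (by rw [h', add_sub_cancel]),
          MulOpposite.op_zero, TensorProduct.tmul_zero]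
  refine isInternal_of_proj _ (fun γ => (mixedProj 𝒜 ℬ γ).toAddMonoidHom)
    (fun γ m hm => (key γ γ m hm).trans (if_pos rfl))
    (fun γ δ h m hm => (key γ δ m hm).trans (if_neg h)) fun m => ?_
  induction m using TensorProduct.induction_on with
  | zero => exact zero_mem _
  | add x y hx hy => exact add_mem hx hy
  | tmul a b =>
    induction b using MulOpposite.rec' with | _ b =>
    induction a using DirectSum.Decomposition.inductionOn 𝒜 with
    | zero => rw [TensorProduct.zero_tmul]; exact zero_mem _
    | add a a' ha ha' => rw [TensorProduct.add_tmul]; exact add_mem ha ha'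
    | homogeneous a =>
      induction b using DirectSum.Decomposition.inductionOn ℬ with
      | zero => rw [MulOpposite.op_zero, TensorProduct.tmul_zero]; exact zero_mem _
      | add b b' hb hb' =>
        rw [MulOpposite.op_add, TensorProduct.tmul_add]; exact add_mem hb hb'
      | homogeneous b =>
        exact AddSubgroup.subset_closure ⟨_, tmul_mem_mixedGrading a.2 b.2⟩

noncomputable instance mixedGradedAlgebra : GradedAlgebra (mixedGrading 𝒜 ℬ) where
  one_mem := by
    have := tmul_mem_mixedGrading (𝒜 := 𝒜) (ℬ := ℬ) (SetLike.GradedOne.one_mem (A := 𝒜))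
      (SetLike.GradedOne.one_mem (A := ℬ))
    rwa [add_zero] at this
  mul_mem := by
    intro γ δ s t hs ht
    induction hs using Submodule.span_induction with
    | zero => rw [zero_mul]; exact zero_mem _
    | add x y _ _ hx hy => rw [add_mul]; exact add_mem hx hy
    | smul c x _ hx => rw [smul_mul_assoc]; exact Submodule.smul_mem _ _ hx
    | mem x hx =>
      induction ht using Submodule.span_induction with
      | zero => rw [mul_zero]; exact zero_mem _
      | add x y _ _ hx hy => rw [mul_add]; exact add_mem hx hy
      | smul c x _ hx => rw [mul_smul_comm]; exact Submodule.smul_mem _ _ hx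
      | mem y hy =>
        obtain ⟨α, β, rfl, a, ha, b, hb, rfl⟩ := hx
        obtain ⟨α', β', rfl, a', ha', b', hb', rfl⟩ := hy
        rw [Algebra.TensorProduct.tmul_mul_tmul, ← MulOpposite.op_mul, add_add_add_comm,
          add_comm β β']
        exact tmul_mem_mixedGrading (SetLike.mul_mem_graded ha ha')
          (SetLike.mul_mem_graded hb' hb)
  __ := mixedGrading_isInternal.chooseDecomposition

end Mixed

/-! ### Normal quotients of tensor products -/

section MixedQuotient

variable {G : Type x} [AddCommGroup G]
variable {K : Type v} [Field K] {A A' B B' : Type u} [Ring A] [Algebra K A] [Ring A'] [Algebra K A']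
  [Ring B] [Algebra K B] [Ring B'] [Algebra K B']
variable {𝒜 : G → Submodule K A} {𝒜' : G → Submodule K A'} {ℬ : G → Submodule K B}
  {ℬ' : G → Submodule K B'}

theorem map_mem_mixedGrading {π : A →ₐ[K] A'} {ρ : B →ₐ[K] B'}
    (hπ : ∀ {γ a}, a ∈ 𝒜 γ → π a ∈ 𝒜' γ) (hρ : ∀ {γ b}, b ∈ ℬ γ → ρ b ∈ ℬ' γ) {γ : G}
    {t : A ⊗[K] Bᵐᵒᵖ} (ht : t ∈ mixedGrading 𝒜 ℬ γ) :
    Algebra.TensorProduct.map π (AlgHom.op ρ) t ∈ mixedGrading 𝒜' ℬ' γ := by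
  induction ht using Submodule.span_induction with
  | zero => rw [map_zero]; exact zero_mem _
  | add x y _ _ hx hy => rw [map_add]; exact add_mem hx hy
  | smul c x _ hx => rw [map_smul]; exact Submodule.smul_mem _ _ hx
  | mem x hx =>
    obtain ⟨α, β, rfl, a, ha, b, hb, rfl⟩ := hx
    exact tmul_mem_mixedGrading (hπ ha) (hρ hb)

theorem exists_lift_mixedGrading {π : A →ₐ[K] A'} {ρ : B →ₐ[K] B'}
    (hπ : ∀ {γ a'}, a' ∈ 𝒜' γ → ∃ a ∈ 𝒜 γ, π a = a')
    (hρ : ∀ {γ b'}, b' ∈ ℬ' γ → ∃ b ∈ ℬ γ, ρ b = b') {γ : G}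
    {t : A' ⊗[K] B'ᵐᵒᵖ} (ht : t ∈ mixedGrading 𝒜' ℬ' γ) :
    ∃ s ∈ mixedGrading 𝒜 ℬ γ, Algebra.TensorProduct.map π (AlgHom.op ρ) s = t := by
  induction ht using Submodule.span_induction with
  | zero => exact ⟨0, zero_mem _, map_zero _⟩
  | add x y _ _ hx hy =>
    obtain ⟨s, hs, rfl⟩ := hx
    obtain ⟨t, ht, rfl⟩ := hy
    exact ⟨s + t, add_mem hs ht, map_add _ _ _⟩
  | smul c x _ hx =>
    obtain ⟨s, hs, rfl⟩ := hx
    exact ⟨c • s, Submodule.smul_mem _ _ hs, map_smul _ _ _⟩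
  | mem x hx =>
    obtain ⟨α, β, rfl, a, ha, b, hb, rfl⟩ := hx
    obtain ⟨a, ha', rfl⟩ := hπ ha
    obtain ⟨b, hb', rfl⟩ := hρ hb
    exact ⟨_, tmul_mem_mixedGrading ha' hb', rfl⟩

variable [DecidableEq G]

/-- Everything is flat over the field: tensoring preserves the injectivity of both multiplications
by `z` and the exactness of `A → A → A'`. Normality is checked on pure tensors and extends
additively. -/
theorem NormalQuotient.tensorRight [GradedAlgebra 𝒜'] [GradedAlgebra ℬ] {π : A →ₐ[K] A'} {z : A}
    {ε : G} (h : NormalQuotient 𝒜 𝒜' (π : A →+* A') z ε) :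
    NormalQuotient (mixedGrading 𝒜 ℬ) (mixedGrading 𝒜' ℬ)
      (Algebra.TensorProduct.map π (AlgHom.op (AlgHom.id K B)) : A ⊗[K] Bᵐᵒᵖ →+* A' ⊗[K] Bᵐᵒᵖ)
      (z ⊗ₜ MulOpposite.op 1) ε where
  mem := by
    have := tmul_mem_mixedGrading (ℬ := ℬ) h.mem SetLike.GradedOne.one_mem
    rwa [add_zero] at this
  isRegular := by
    constructor
    · have hl := Module.Flat.rTensor_preserves_injective_linearMap (M := Bᵐᵒᵖ)
        (LinearMap.mulLeft K z) h.isRegular.left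
      have : (LinearMap.mulLeft K z).rTensor Bᵐᵒᵖ =
          LinearMap.mulLeft K (z ⊗ₜ[K] (MulOpposite.op 1 : Bᵐᵒᵖ)) :=
        TensorProduct.ext' fun a b => by simp
      rw [this] at hl
      exact hl
    · have hl := Module.Flat.rTensor_preserves_injective_linearMap (M := Bᵐᵒᵖ)
        (LinearMap.mulRight K z) h.isRegular.right
      have : (LinearMap.mulRight K z).rTensor Bᵐᵒᵖ =
          LinearMap.mulRight K (z ⊗ₜ[K] (MulOpposite.op 1 : Bᵐᵒᵖ)) :=
        TensorProduct.ext' fun a b => by simp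
      rw [this] at hl
      exact hl
  exists_mul_left t := by
    induction t using TensorProduct.induction_on with
    | zero => exact ⟨0, by simp⟩
    | add x y hx hy =>
      obtain ⟨s, hs⟩ := hx
      obtain ⟨t, ht⟩ := hy
      exact ⟨s + t, by rw [mul_add, add_mul, hs, ht]⟩
    | tmul a b =>
      obtain ⟨a', ha'⟩ := h.exists_mul_left a
      exact ⟨a' ⊗ₜ b, by simp [ha']⟩
  exists_mul_right t := by
    induction t using TensorProduct.induction_on with
    | zero => exact ⟨0, by simp⟩
    | add x y hx hy =>
      obtain ⟨s, hs⟩ := hx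
      obtain ⟨t, ht⟩ := hy
      exact ⟨s + t, by rw [mul_add, add_mul, hs, ht]⟩
    | tmul a b =>
      obtain ⟨a', ha'⟩ := h.exists_mul_right a
      exact ⟨a' ⊗ₜ b, by simp [ha']⟩
  map_mem := map_mem_mixedGrading h.map_mem fun hb => hb
  exists_lift := exists_lift_mixedGrading h.exists_lift fun hb => ⟨_, hb, rfl⟩
  map_eq_zero_iff t := by
    have hex := rTensor_exact Bᵐᵒᵖ (f := LinearMap.mulLeft K z) (g := π.toLinearMap)
      (fun a => (h.map_eq_zero_iff a).trans
        ⟨fun ⟨b, hb⟩ => ⟨b, hb.symm⟩, fun ⟨b, hb⟩ => ⟨b, hb.symm⟩⟩) h.surjective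
    have h1 : (LinearMap.mulLeft K z).rTensor Bᵐᵒᵖ =
        LinearMap.mulLeft K (z ⊗ₜ[K] (MulOpposite.op 1 : Bᵐᵒᵖ)) :=
      TensorProduct.ext' fun a b => by simp
    rw [h1] at hex
    exact (hex t).trans ⟨fun ⟨b, hb⟩ => ⟨b, hb.symm⟩, fun ⟨b, hb⟩ => ⟨b, hb.symm⟩⟩

/-- Passing to the opposite algebra exchanges left and right multiplication by `z`, so each side of
regularity and normality is supplied by the other. -/
theorem NormalQuotient.tensorLeft [GradedAlgebra 𝒜] [GradedAlgebra ℬ'] {π : B →ₐ[K] B'} {z : B}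
    {ε : G} (h : NormalQuotient ℬ ℬ' (π : B →+* B') z ε) :
    NormalQuotient (mixedGrading 𝒜 ℬ) (mixedGrading 𝒜 ℬ')
      (Algebra.TensorProduct.map (AlgHom.id K A) (AlgHom.op π) : A ⊗[K] Bᵐᵒᵖ →+* A ⊗[K] B'ᵐᵒᵖ)
      (1 ⊗ₜ MulOpposite.op z) ε where
  mem := by
    have := tmul_mem_mixedGrading (𝒜 := 𝒜) SetLike.GradedOne.one_mem h.mem
    rwa [zero_add] at this
  isRegular := by
    constructor
    · have hl := Module.Flat.lTensor_preserves_injective_linearMap (M := A)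
        (LinearMap.mulLeft K (MulOpposite.op z)) fun a b hab =>
          MulOpposite.unop_injective (h.isRegular.right (MulOpposite.op_injective hab))
      have : (LinearMap.mulLeft K (MulOpposite.op z)).lTensor A =
          LinearMap.mulLeft K ((1 : A) ⊗ₜ[K] MulOpposite.op z) :=
        TensorProduct.ext' fun a b => by simp
      rw [this] at hl
      exact hl
    · have hl := Module.Flat.lTensor_preserves_injective_linearMap (M := A)
        (LinearMap.mulRight K (MulOpposite.op z)) fun a b hab =>
          MulOpposite.unop_injective (h.isRegular.left (MulOpposite.op_injective hab))
      have : (LinearMap.mulRight K (MulOpposite.op z)).lTensor A =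
          LinearMap.mulRight K ((1 : A) ⊗ₜ[K] MulOpposite.op z) :=
        TensorProduct.ext' fun a b => by simp
      rw [this] at hl
      exact hl
  exists_mul_left t := by
    induction t using TensorProduct.induction_on with
    | zero => exact ⟨0, by simp⟩
    | add x y hx hy =>
      obtain ⟨s, hs⟩ := hx
      obtain ⟨t, ht⟩ := hy
      exact ⟨s + t, by rw [mul_add, add_mul, hs, ht]⟩
    | tmul a b =>
      obtain ⟨b', hb'⟩ := h.exists_mul_right b.unop
      refine ⟨a ⊗ₜ MulOpposite.op b', ?_⟩
      rw [Algebra.TensorProduct.tmul_mul_tmul, Algebra.TensorProduct.tmul_mul_tmul, one_mul,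
        mul_one, ← MulOpposite.op_mul, ← hb', MulOpposite.op_mul, MulOpposite.op_unop]
  exists_mul_right t := by
    induction t using TensorProduct.induction_on with
    | zero => exact ⟨0, by simp⟩
    | add x y hx hy =>
      obtain ⟨s, hs⟩ := hx
      obtain ⟨t, ht⟩ := hy
      exact ⟨s + t, by rw [mul_add, add_mul, hs, ht]⟩
    | tmul a b =>
      obtain ⟨b', hb'⟩ := h.exists_mul_left b.unop
      refine ⟨a ⊗ₜ MulOpposite.op b', ?_⟩
      rw [Algebra.TensorProduct.tmul_mul_tmul, Algebra.TensorProduct.tmul_mul_tmul, one_mul,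
        mul_one, ← MulOpposite.op_mul, ← hb', MulOpposite.op_mul, MulOpposite.op_unop]
  map_mem := map_mem_mixedGrading (fun ha => ha) h.map_mem
  exists_lift := exists_lift_mixedGrading (fun ha => ⟨_, ha, rfl⟩) h.exists_lift
  map_eq_zero_iff t := by
    have hex := lTensor_exact A (f := LinearMap.mulLeft K (MulOpposite.op z))
      (g := (AlgHom.op π).toLinearMap) (fun a => by
        refine (MulOpposite.op_eq_zero_iff _).trans ((h.map_eq_zero_iff a.unop).trans ?_)
        constructor
        · rintro ⟨b, hb⟩
          obtain ⟨c, hc⟩ := h.exists_mul_left b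
          exact ⟨MulOpposite.op c, MulOpposite.unop_injective (hc.symm.trans hb.symm)⟩
        · rintro ⟨b, rfl⟩
          exact h.exists_mul_right b.unop)
      (fun b => by
        obtain ⟨a, ha⟩ := h.surjective b.unop
        exact ⟨MulOpposite.op a, MulOpposite.unop_injective ha⟩)
    have h1 : (LinearMap.mulLeft K (MulOpposite.op z)).lTensor A =
        LinearMap.mulLeft K ((1 : A) ⊗ₜ[K] MulOpposite.op z) :=
      TensorProduct.ext' fun a b => by simp
    rw [h1] at hex
    exact (hex t).trans ⟨fun ⟨b, hb⟩ => ⟨b, hb.symm⟩, fun ⟨b, hb⟩ => ⟨b, hb.symm⟩⟩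

end MixedQuotient

/-! ### Smoothness of normal extensions -/

section NormalExtension

variable {G : Type x} [AddCommGroup G] [DecidableEq G]
variable {K : Type v} [Field K] {R : Type u} [Ring R] [Algebra K R]
variable {𝒜 : G → Submodule K R} [GradedAlgebra 𝒜] {z : R} {ε : G}

theorem IsNormalExtensionElement.normalQuotient (hz : IsNormalExtensionElement 𝒜 z ε) :
    NormalQuotient 𝒜 (quotientGrading hz.ideal)
      (Ideal.Quotient.mkₐ K hz.ideal.toIdeal : R →+* R ⧸ hz.ideal.toIdeal) z ε where
  mem := hz.mem
  isRegular := hz.isRegular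
  exists_mul_left a := by
    obtain ⟨b, hb⟩ : z * a ∈ Set.range (fun a : R => a * z) := hz.normal ▸ ⟨a, rfl⟩
    exact ⟨b, hb.symm⟩
  exists_mul_right a := by
    obtain ⟨b, hb⟩ : a * z ∈ Set.range (fun a : R => z * a) := hz.normal ▸ ⟨a, rfl⟩
    exact ⟨b, hb.symm⟩
  map_mem ha := ⟨_, ha, rfl⟩
  exists_lift hb := hb
  map_eq_zero_iff a := by
    refine Ideal.Quotient.eq_zero_iff_mem.trans (Ideal.mem_span_singleton'.trans ?_)
    constructor
    · rintro ⟨b, rfl⟩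
      obtain ⟨c, hc⟩ : b * z ∈ Set.range (fun a : R => z * a) := hz.normal ▸ ⟨b, rfl⟩
      exact ⟨c, hc.symm⟩
    · rintro ⟨b, rfl⟩
      obtain ⟨c, hc⟩ : z * b ∈ Set.range (fun a : R => a * z) := hz.normal ▸ ⟨b, rfl⟩
      exact ⟨c, hc⟩

/-- Makes the reduction `R → R̄` linear for the enveloping action. The map of enveloping algebras is
split in two to match the iterated restriction of scalars. -/
theorem map_moduleAux {A A' : Type u} [Ring A] [Algebra K A] [Ring A'] [Algebra K A']
    (π : A →ₐ[K] A') (t : A ⊗[K] Aᵐᵒᵖ) (m : A) :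
    π (TensorProduct.Algebra.moduleAux (R := K) (A := A) (B := Aᵐᵒᵖ) (M := A) t m) =
      TensorProduct.Algebra.moduleAux (R := K) (A := A') (B := A'ᵐᵒᵖ) (M := A')
        (Algebra.TensorProduct.map (AlgHom.id K A') (AlgHom.op π)
          (Algebra.TensorProduct.map π (AlgHom.op (AlgHom.id K A)) t)) (π m) := by
  induction t using TensorProduct.induction_on with
  | zero => simp
  | add s t hs ht => simp only [map_add, LinearMap.add_apply, hs, ht]
  | tmul a b => simp [TensorProduct.Algebra.moduleAux_apply]

theorem isHomologicallySmooth_of_quotient (hz : IsNormalExtensionElement 𝒜 z ε) (p : G →+ ℤ)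
    (hp : ∀ γ : G, 𝒜 γ ≠ ⊥ → 0 ≤ p γ) (hε : 0 < p ε)
    (hsmooth : IsHomologicallySmooth (quotientGrading hz.ideal)) : IsHomologicallySmooth 𝒜 := by
  have hp' : ∀ γ, quotientGrading hz.ideal γ ≠ ⊥ → 0 ≤ p γ := fun γ hγ => hp γ fun h => hγ (by
    rw [quotientGrading, h, Submodule.map_bot])
  let h₁ := hz.normalQuotient.tensorRight (ℬ := 𝒜)
  let h₂ := hz.normalQuotient.tensorLeft (𝒜 := quotientGrading hz.ideal)
  obtain ⟨n, hn⟩ := hasBoundedFGProjectiveResolution_iff.1 hsmooth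
  -- `envGrading` is by definition `mixedGrading` with both gradings equal.
  let Q : GrMod.{u, v, u} (mixedGrading (quotientGrading hz.ideal) (quotientGrading hz.ideal)) :=
    regularBimodule (quotientGrading hz.ideal)
  obtain ⟨X, i, hi, hex⟩ := GrMod.exists_ker (GrHom.id (h₂.res Q))
  have hX : Subsingleton X.carrier := ⟨fun x y =>
    hi (((hex _).2 ⟨x, rfl⟩).trans ((hex _).2 ⟨y, rfl⟩).symm)⟩
  -- The change of rings starts from the identity of `R̄`, whose kernel `X = 0` is projective.
  have hres : HasRes (n + 1) (h₂.res Q) :=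
    h₂.hasRes_of_projective_ker (nonneg_of_mixedGrading_ne_bot hp' hp) hε hn _ X
      (GrHom.id _) i Function.surjective_id hi hex X.isProjective_of_subsingleton inferInstance
  let M : GrMod.{u, v, u} (mixedGrading 𝒜 𝒜) := regularBimodule 𝒜
  let q : GrHom M (h₁.res (h₂.res Q)) :=
    { toLinearMap :=
        { toFun := fun m : R => Ideal.Quotient.mk hz.ideal.toIdeal m
          map_add' := map_add (Ideal.Quotient.mk hz.ideal.toIdeal)
          map_smul' := map_moduleAux (Ideal.Quotient.mkₐ K hz.ideal.toIdeal) }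
      map_mem := fun {γ m} hm => ⟨m, hm, rfl⟩ }
  have hzsmul : ∀ m : R, (show R from (z ⊗ₜ[K] MulOpposite.op 1 : R ⊗[K] Rᵐᵒᵖ) •
      (show M.carrier from m)) = z * m := fun m =>
    (regularBimodule_smul_def 𝒜 z 1 m).trans (by rw [mul_one])
  -- On `R` the element `z ⊗ 1` acts as left multiplication by `z`, so regularity gives
  -- torsion-freeness and the kernel of `q` is `zR`. The lower bound `0` is the positivity of `p` on
  -- the degrees of `R`.
  refine hasBoundedFGProjectiveResolution_iff.2 ⟨n + 1,
    h₁.hasRes_of_torsionFree (nonneg_of_mixedGrading_ne_bot hp hp) hε hres M q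
      (Ideal.Quotient.mk_surjective (I := hz.ideal.toIdeal)) ?_ ?_ ⟨0, fun γ hγ m hm => ?_⟩⟩
  · intro m
    exact (hz.normalQuotient.map_eq_zero_iff (show R from m)).trans
      (exists_congr fun y => Eq.congr_right (hzsmul y).symm)
  · intro m hm
    have hm' : z * (show R from m) = 0 := (hzsmul m).symm.trans hm
    exact hz.isRegular.left.mul_left_eq_zero_iff.1 hm'
  · by_contra hne
    refine hγ.not_ge (hp γ fun h => hne ?_)
    have hm' : (show R from m) ∈ 𝒜 γ := hm
    rw [h] at hm'
    exact (Submodule.mem_bot (M := R) K).1 hm'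

end NormalExtension

end NormalExt

theorem mainTheorem4 {G : Type*} [AddCommGroup G] [DecidableEq G] {K : Type*} [Field K]
    {R : Type*} [Ring R] [Algebra K R] (𝒜 : G → Submodule K R) [GradedAlgebra 𝒜]
    (z : R) (ε : G) (hz : NormalExt.IsNormalExtensionElement 𝒜 z ε)
    (p : G →+ ℤ) (hp : ∀ γ : G, 𝒜 γ ≠ ⊥ → 0 ≤ p γ) (hε : 0 < p ε)
    (hsmooth : NormalExt.IsHomologicallySmooth (NormalExt.quotientGrading hz.ideal)) :
    NormalExt.IsHomologicallySmooth 𝒜 := 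
  NormalExt.isHomologicallySmooth_of_quotient hz p hp hε hsmooth
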